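/- **Theorem (abundance of least expanding points).** Let $m_1>m_2\ge m_3>0$ be masses with $2\sqrt{m_1}\sqrt{m_3}=\sqrt{m_1+m_2}\,\sqrt{m_2+m_3}$ and let $c>0$. Consider three point balls with positions $0\le q_1\le q_2\le q_3$, momenta $p_i=m_iv_i$ and Hamiltonian $H(q,p)=\sum_{i=1}^3\big(\tfrac{p_i^2}{2m_i}+m_iq_i\big)=c$. Between collisions they follow $\phi^t(q,p)=(q_i+tv_i-\tfrac{t^2}{2},\,p_i-tm_i)_i$. When $q_1=0$ and $v_1<0$, ball $1$ collides with the floor, $p_1\mapsto -p_1$; when $q_i=q_{i+1}$ and $v_i>v_{i+1}$, the balls $i,i+1$ collide elastically, $(p_i,p_{i+1})\mapsto(\gamma_ip_i+(1+\gamma_i)p_{i+1},\,(1-\gamma_i)p_i-\gamma_ip_{i+1})$, $\gamma_i=\frac{m_i-m_{i+1}}{m_i+m_{i+1}}$. Let $\mathcal M^+=\mathcal M^+_1\cup\mathcal M^+_2\cup\mathcal M^+_3\subset\mathbb R^6$ be the set of admissible states of energy $c$ right after a collision ($q_1=0,\ v_1\ge 0$ for $\mathcal M_1^+$; $q_{i-1}=q_i,\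 v_{i-1}\le v_i$ for $\mathcal M_i^+$, $i=2,3$), with the smooth measure $\mu$ given by the volume form $\iota(X_H)\iota(u)\bigwedge_i dq_i\wedge dp_i$, where $X_H$ is the Hamiltonian vector field and $dH(u)=1$. Let $T$ be the collision map: follow the flow, within the admissible states, up to the first time $\tau\ge0$ at which a collision is due, and apply the collision. If several collisions are due at that time, $T$ has one branch for each of them, and the motion is continued on all branches. Each branch of $T^n$ is differentiated as the smooth map defined near the point by the same sequence of collisions. Let $h_i=\tfrac{p_i^2}{2m_i}+m_iq_i$, $\xi=A^{-1}h$, $\eta=A^{\mathsf T}v$, where the columns of $A$ are $\frac{1}{m_1+m_2+m_3}(m_1,m_2,m_3)$, $(1,-1,0)$ and $(0,1,-1)$; so $\xi_1=H$, and the flow moves only $\eta_1$. Write $d_xT^n$ for the derivative of (a branch of) $T^n$ in the coordinates $(\xi,\eta)$, and put $Q(\delta\xi,\delta\eta)=\sum_{i=1}^3\delta\xi_i\,\delta\eta_i$, $$\mathcal C=\{(\delta\xi,\delta\eta)\in\mathbb R^3\times\mathbb R^3: Q(\delta\xi,\delta\eta)>0,\ \delta\xi_1=\delta\eta_1=0\}\cup\{0\},\qquad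 \sigma(d_xT^n)=\inf_{v\in\mathcal C\setminus\{0\}}\sqrt{\frac{Q(d_xT^nv)}{Q(v)}} .$$ A point $x\in\mathcal M^+$ is called *least expanding* if there is $n\ge1$ such that $T^n$ is defined at $x$ on at least one branch, and $\sigma(d_xT^n)>1$ on every branch of $T^n$ at $x$. Then the set of least expanding points has full $\mu$-measure in $\mathcal M^+$ and is arcwise connected: any two least expanding points are joined by a continuous curve of least expanding points, and the set is nonempty. -/

import Mathlib

open scoped Matrix
open MeasureTheory

/-! Three balls of masses `m 0, m 1, m 2` on a vertical half line above a floor at height `0`,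
under constant gravity, with elastic collisions. -/

noncomputable section

namespace FallingBalls

/-- Pairs of vectors of `ℝ³`: phase points `(q, p)`, points `(ξ, η)`, tangent vectors
`(δξ, δη)`. -/
abbrev Phase : Type := (Fin 3 → ℝ) × (Fin 3 → ℝ)

/-- The Hamiltonian `H(q, p) = ∑ pᵢ² / (2 mᵢ) + mᵢ qᵢ`. -/
def hamiltonian (m : Fin 3 → ℝ) (x : Phase) : ℝ :=
  ∑ i, (x.2 i ^ 2 / (2 * m i) + m i * x.1 i)

/-- The velocities `vᵢ = pᵢ / mᵢ`. -/
def vel (m : Fin 3 → ℝ) (x : Phase) (i : Fin 3) : ℝ := x.2 i / m i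

/-- The admissible states `0 ≤ q₀ ≤ q₁ ≤ q₂`. -/
def admissible : Set Phase :=
  {x | 0 ≤ x.1 0 ∧ x.1 0 ≤ x.1 1 ∧ x.1 1 ≤ x.1 2}

/-- The gap which closes at a collision of type `j`. Type `0` is the collision of the lowest
ball with the floor, type `1` the collision of the lower two balls, type `2` the collision of the
upper two balls. -/
def gap (j : Fin 3) (x : Phase) : ℝ :=
  ![x.1 0, x.1 1 - x.1 0, x.1 2 - x.1 1] j

/-- The velocity with which the gap `j` grows. -/
def gapVel (m : Fin 3 → ℝ) (j : Fin 3) (x : Phase) : ℝ :=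
  ![vel m x 0, vel m x 1 - vel m x 0, vel m x 2 - vel m x 1] j

/-- States of energy `c` right after a collision of type `j`. -/
def sectionPlus (m : Fin 3 → ℝ) (c : ℝ) (j : Fin 3) : Set Phase :=
  {x | hamiltonian m x = c ∧ x ∈ admissible ∧ gap j x = 0 ∧ 0 ≤ gapVel m j x}

/-- States of energy `c` right before a collision of type `j`. -/
def sectionMinus (m : Fin 3 → ℝ) (c : ℝ) (j : Fin 3) : Set Phase :=
  {x | hamiltonian m x = c ∧ x ∈ admissible ∧ gap j x = 0 ∧ gapVel m j x < 0}

/-- The Poincaré section `𝓜⁺`: all states right after a collision. -/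
def phaseSpace (m : Fin 3 → ℝ) (c : ℝ) : Set Phase := ⋃ j, sectionPlus m c j

/-- The Hamiltonian flow between collisions. -/
def flow (m : Fin 3 → ℝ) (t : ℝ) (x : Phase) : Phase :=
  (fun i => -t ^ 2 / 2 + t * (x.2 i / m i) + x.1 i, fun i => x.2 i - t * m i)

/-- `γ = (a - b) / (a + b)` for two colliding balls of masses `a` (lower) and `b` (upper). -/
def massRatio (a b : ℝ) : ℝ := (a - b) / (a + b)

/-- The elastic collision of type `j`. -/
def collision (m : Fin 3 → ℝ) (j : Fin 3) (x : Phase) : Phase :=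
  (x.1,
    ![![-x.2 0, x.2 1, x.2 2],
      ![massRatio (m 0) (m 1) * x.2 0 + (1 + massRatio (m 0) (m 1)) * x.2 1,
        (1 - massRatio (m 0) (m 1)) * x.2 0 - massRatio (m 0) (m 1) * x.2 1,
        x.2 2],
      ![x.2 0,
        massRatio (m 1) (m 2) * x.2 1 + (1 + massRatio (m 1) (m 2)) * x.2 2,
        (1 - massRatio (m 1) (m 2)) * x.2 1 - massRatio (m 1) (m 2) * x.2 2]] j)

/-! ### The collision map `T`

`T` follows the flow up to the first time at which the state is right before a collision, and
then applies the collision. If several collisions are due at that time (a singularity), `T` is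
multivalued: the motion is continued on every branch. -/

/-- `y` is the image of `x` under the branch of `T` whose collision has type `j`. -/
def Step (m : Fin 3 → ℝ) (c : ℝ) (j : Fin 3) (x y : Phase) : Prop :=
  ∃ τ : ℝ, 0 ≤ τ ∧
    (∀ t ∈ Set.Icc 0 τ, flow m t x ∈ admissible) ∧
    (∀ t ∈ Set.Ico 0 τ, ∀ k, flow m t x ∉ sectionMinus m c k) ∧
    flow m τ x ∈ sectionMinus m c j ∧
    y = collision m j (flow m τ x)

/-- The word `w` is the list of the collision types of a branch of `T ^ w.length` at `x`. -/
def IsBranch (m : Fin 3 → ℝ) (c : ℝ) : List (Fin 3) → Phase → Prop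
  | [], _ => True
  | j :: w, x => ∃ y, Step m c j x y ∧ IsBranch m c w y

/-- The time up to the next collision of type `j`, as an explicit function of the state; it is
smooth near every state whose next collision has type `j`. -/
def hitTime (m : Fin 3 → ℝ) (j : Fin 3) (x : Phase) : ℝ :=
  ![vel m x 0 + √(vel m x 0 ^ 2 + 2 * x.1 0),
    (x.1 1 - x.1 0) / (vel m x 0 - vel m x 1),
    (x.1 2 - x.1 1) / (vel m x 1 - vel m x 2)] j

/-- Whenever the free flight of `x` arrives at a collision of type `j`, it does so at the time
`hitTime m j x`. -/
theorem eq_hitTime {m : Fin 3 → ℝ} (hm : ∀ i, m i ≠ 0) {c : ℝ} {j : Fin 3} {x : Phase} {t : ℝ}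
    (h : flow m t x ∈ sectionMinus m c j) : t = hitTime m j x := by
  obtain ⟨-, -, h0, h1⟩ := h
  have hv : ∀ i, (x.2 i - t * m i) / m i = x.2 i / m i - t := fun i => by
    have := hm i
    field_simp
  fin_cases j
  · simp [gap, gapVel, flow, vel, hitTime, hv] at h0 h1 ⊢
    have : (x.2 0 / m 0) ^ 2 + 2 * x.1 0 = (t - x.2 0 / m 0) ^ 2 := by linarith
    rw [this, Real.sqrt_sq (by linarith)]
    ring
  · simp [gap, gapVel, flow, vel, hitTime, hv] at h0 h1 ⊢
    rw [eq_div_iff (by linarith)]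
    linarith
  · simp [gap, gapVel, flow, vel, hitTime, hv] at h0 h1 ⊢
    rw [eq_div_iff (by linarith)]
    linarith

/-- The branch of `T` belonging to collision type `j`, as a map defined by the same formula off
the section. -/
def branchMap (m : Fin 3 → ℝ) (j : Fin 3) (x : Phase) : Phase :=
  collision m j (flow m (hitTime m j x) x)

/-- The branch of `T ^ w.length` with the collision types `w`. -/
def branchIter (m : Fin 3 → ℝ) : List (Fin 3) → Phase → Phase
  | [] => id
  | j :: w => branchIter m w ∘ branchMap m j

/-! ### The coordinates `(ξ, η)` -/

/-- The matrix `A` of the linear change of coordinates `ξ = A⁻¹ h`, `η = Aᵀ v`. -/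
def coordMatrix (m : Fin 3 → ℝ) : Matrix (Fin 3) (Fin 3) ℝ :=
  !![m 0 / (m 0 + m 1 + m 2), 1, 0;
     m 1 / (m 0 + m 1 + m 2), -1, 1;
     m 2 / (m 0 + m 1 + m 2), 0, -1]

/-- The change of coordinates `(q, p) ↦ (h, v) ↦ (ξ, η)`, where `hᵢ = pᵢ² / (2 mᵢ) + mᵢ qᵢ`. In
these coordinates the energy is `ξ₀` and the flow moves only `η₀`, at speed `-1`. -/
def toXiEta (m : Fin 3 → ℝ) (x : Phase) : Phase :=
  ((coordMatrix m)⁻¹ *ᵥ fun i => x.2 i ^ 2 / (2 * m i) + m i * x.1 i,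
    (coordMatrix m)ᵀ *ᵥ fun i => x.2 i / m i)

/-- The inverse change of coordinates `(ξ, η) ↦ (q, p)`. -/
def fromXiEta (m : Fin 3 → ℝ) (z : Phase) : Phase :=
  (fun i => (coordMatrix m *ᵥ z.1) i / m i - (((coordMatrix m)ᵀ)⁻¹ *ᵥ z.2) i ^ 2 / 2,
    fun i => m i * (((coordMatrix m)ᵀ)⁻¹ *ᵥ z.2) i)

theorem det_coordMatrix {m : Fin 3 → ℝ} (hM : m 0 + m 1 + m 2 ≠ 0) :
    (coordMatrix m).det = 1 := by
  simp [coordMatrix, Matrix.det_fin_three]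
  field_simp

theorem fromXiEta_toXiEta {m : Fin 3 → ℝ} (hm : ∀ i, m i ≠ 0) (hM : m 0 + m 1 + m 2 ≠ 0)
    (x : Phase) : fromXiEta m (toXiEta m x) = x := by
  have hA : IsUnit (coordMatrix m).det := by simp [det_coordMatrix hM]
  have hAt : IsUnit ((coordMatrix m)ᵀ).det := by simp [det_coordMatrix hM]
  ext i
  · have := hm i
    simp [fromXiEta, toXiEta, Matrix.mulVec_mulVec, Matrix.mul_nonsing_inv _ hA,
      Matrix.nonsing_inv_mul _ hAt]
    field_simp
    ring
  · have := hm i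
    simp [fromXiEta, toXiEta, Matrix.mulVec_mulVec, Matrix.nonsing_inv_mul _ hAt]
    field_simp

theorem toXiEta_fromXiEta {m : Fin 3 → ℝ} (hm : ∀ i, m i ≠ 0) (hM : m 0 + m 1 + m 2 ≠ 0)
    (z : Phase) : toXiEta m (fromXiEta m z) = z := by
  have hA : IsUnit (coordMatrix m).det := by simp [det_coordMatrix hM]
  have hAt : IsUnit ((coordMatrix m)ᵀ).det := by simp [det_coordMatrix hM]
  have h1 : (fun i => (fromXiEta m z).2 i ^ 2 / (2 * m i) + m i * (fromXiEta m z).1 i)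
      = coordMatrix m *ᵥ z.1 := by
    ext i
    have := hm i
    simp only [fromXiEta]
    field_simp
    ring
  have h2 : (fun i => (fromXiEta m z).2 i / m i) = ((coordMatrix m)ᵀ)⁻¹ *ᵥ z.2 := by
    ext i
    have := hm i
    simp only [fromXiEta]
    field_simp
  unfold toXiEta
  rw [h1, h2]
  simp [Matrix.mulVec_mulVec, Matrix.nonsing_inv_mul _ hA, Matrix.mul_nonsing_inv _ hAt]

/-! ### The cone field and the least expansion coefficient -/

/-- The derivative `d_x T^n`, `n = w.length`, of the branch with the collision types `w`, in the
coordinates `(ξ, η)`. -/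
def derivBranch (m : Fin 3 → ℝ) (w : List (Fin 3)) (x : Phase) : Phase →L[ℝ] Phase :=
  fderiv ℝ (toXiEta m ∘ branchIter m w ∘ fromXiEta m) (toXiEta m x)

/-- The quadratic form `Q(δξ, δη) = ∑ δξᵢ δηᵢ`. -/
def Q (v : Phase) : ℝ := ∑ i, v.1 i * v.2 i

/-- The cone `𝓒(x)`; in the coordinates `(ξ, η)` it does not depend on `x`. -/
def cone : Set Phase := {v | 0 < Q v ∧ v.1 0 = 0 ∧ v.2 0 = 0} ∪ {0}

/-- The least expansion coefficient `σ(L) = inf √(Q (L v) / Q v)` over the nonzero `v` of the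
cone. -/
def leastExpansion (L : Phase →L[ℝ] Phase) : ℝ :=
  ⨅ v : (cone \ {0} : Set Phase), √(Q (L v) / Q v)

/-- The least expanding points: some iterate `T ^ n`, `n ≥ 1`, is defined at `x` and satisfies
`σ(d_x T^n) > 1`, on every branch if there are several. -/
def leastExpanding (m : Fin 3 → ℝ) (c : ℝ) : Set Phase :=
  {x | x ∈ phaseSpace m c ∧ ∃ n : ℕ, 1 ≤ n ∧
    (∃ w : List (Fin 3), w.length = n ∧ IsBranch m c w x) ∧
    ∀ w : List (Fin 3), w.length = n → IsBranch m c w x →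
      1 < leastExpansion (derivBranch m w x)}

/-! ### The smooth invariant measure on `𝓜⁺`

It is the measure of the volume form `ι(X_H) ι(u) Ω`, where `Ω` is the symplectic volume form
(up to sign, the determinant in the coordinates `(q, p)`), `X_H` the Hamiltonian vector field,
and `u` any vector with `dH(u) = 1`; here `u = (1 / m₀) ∂/∂q₀`. Each `𝓜ⱼ⁺` is covered, up to a
null set, by one chart. -/

/-- The Hamiltonian vector field. -/
def hamiltonianField (m : Fin 3 → ℝ) (x : Phase) : Phase :=
  (fun i => x.2 i / m i, fun i => -m i)

/-- A vector `u` with `dH(u) = 1`. -/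
def transverse (m : Fin 3 → ℝ) : Phase := (![1 / m 0, 0, 0], 0)

/-- `|Ω(u, X_H(x), b 0, b 1, b 2, b 3)|`. -/
def formDensity (m : Fin 3 → ℝ) (x : Phase) (b : Fin 4 → Phase) : ℝ :=
  |Matrix.det (Matrix.of fun i : Fin 6 =>
    (fun v : Phase => ![v.1 0, v.1 1, v.1 2, v.2 0, v.2 1, v.2 2])
      (![transverse m, hamiltonianField m x, b 0, b 1, b 2, b 3] i))|

/-- The energy which is left for the relative motion of the colliding objects, as a function of
the chart coordinates of `𝓜ⱼ⁺`: the two free positions `y 0 ≤ y 1` and the corresponding momenta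
`y 2`, `y 3` (the total momentum, if the position is shared by two balls). -/
def restEnergy (m : Fin 3 → ℝ) (c : ℝ) (j : Fin 3) (y : Fin 4 → ℝ) : ℝ :=
  ![c - y 2 ^ 2 / (2 * m 1) - y 3 ^ 2 / (2 * m 2) - m 1 * y 0 - m 2 * y 1,
    c - y 2 ^ 2 / (2 * (m 0 + m 1)) - y 3 ^ 2 / (2 * m 2) - (m 0 + m 1) * y 0 - m 2 * y 1,
    c - y 2 ^ 2 / (2 * m 0) - y 3 ^ 2 / (2 * (m 1 + m 2)) - m 0 * y 0 - (m 1 + m 2) * y 1] j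

/-- The chart of `𝓜ⱼ⁺`. -/
def chart (m : Fin 3 → ℝ) (c : ℝ) (j : Fin 3) (y : Fin 4 → ℝ) : Phase :=
  (![![0, y 0, y 1], ![y 0, y 0, y 1], ![y 0, y 1, y 1]] j,
   ![![√(2 * m 0 * restEnergy m c 0 y), y 2, y 3],
     ![m 0 / (m 0 + m 1) * y 2 - √(2 * (m 0 * m 1 / (m 0 + m 1)) * restEnergy m c 1 y),
       m 1 / (m 0 + m 1) * y 2 + √(2 * (m 0 * m 1 / (m 0 + m 1)) * restEnergy m c 1 y),
       y 3],
     ![y 2,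
       m 1 / (m 1 + m 2) * y 3 - √(2 * (m 1 * m 2 / (m 1 + m 2)) * restEnergy m c 2 y),
       m 2 / (m 1 + m 2) * y 3 + √(2 * (m 1 * m 2 / (m 1 + m 2)) * restEnergy m c 2 y)]] j)

/-- The domain of the chart of `𝓜ⱼ⁺`. -/
def chartDomain (m : Fin 3 → ℝ) (c : ℝ) (j : Fin 3) : Set (Fin 4 → ℝ) :=
  {y | 0 ≤ y 0 ∧ y 0 ≤ y 1 ∧ 0 < restEnergy m c j y}

/-- The measure `μ` on `𝓜⁺` given by the volume form `ι(X_H) ι(u) Ω`. -/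
def sectionMeasure (m : Fin 3 → ℝ) (c : ℝ) : Measure Phase :=
  ∑ j, Measure.map (chart m c j)
    ((volume.restrict (chartDomain m c j)).withDensity fun y =>
      ENNReal.ofReal (formDensity m (chart m c j y)
        fun k => fderiv ℝ (chart m c j) y (Pi.single k 1)))

end FallingBalls

end

/-! Restrict to `δξ₀ = 0` and call the lower mass ratio `γ`. Every collision raises `Q` by a
nonnegative term: `k δξ₁²` at the floor, `k δη₁²` or `k δη₂²` when balls collide. Here `k > 0`,
because the landing speed is positive, the masses decrease upwards and colliding balls approach each
other. If `Q` does not grow along a branch, these squares vanish, and the ball-ball collisions act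
on `δξ` as two fixed reflections. The mass condition says that their mirrors meet at the angle `π /
3`, so that they generate `S₃`; in the coordinates `zeta` they are the adjacent transpositions.
Hence a branch along which each of the three labels has hit the floor is strictly monotone on all of
`δξ₀ = δη₀ = 0` (`Q_derivBranch`, `Q_lt_derivBranch`), and compactness of the unit sphere turns this
into `σ > 1` (`one_lt_leastExpansion`).

The same permutations act on suitable linear coordinates of positions and velocities (`labelPos`,
`labelVel`): the labels fall freely and pass through each other, and when one hits the floor with
speed `a`, its velocity grows by `2a` and the other two by `2γa`. Suppose that an infinite branch
never brings some label to the floor. A combination of the three velocities then decreases at a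
fixed positive rate in time, so the total time is finite, the hit speeds are summable, and the
energies of the two other labels converge. A label that hits infinitely often loses all its energy
in the limit, which contradicts a conservation law (`false_of_frequently_hits`). By König's lemma,
all sufficiently long branches at a given state hit the floor with all labels
(`exists_forall_mem_hits`).

It remains to know that the motion can be continued forever on some branch. This holds for
`Outgoing` states: a multiple collision can always be resolved in an order that leads to an outgoing
state again. In particular every state of the section in which all closed gaps are opening is least
expanding (`WideMasses.regularSection_subset`). Such states have full measure, and the segment from
any point of `𝓜ⱼ⁺` towards a state with opening gaps, rescaled to the energy `c`, runs through them
immediately. This gives path connectedness. -/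

noncomputable section

namespace FallingBalls

/-! ### Masses and mass ratios -/

/-- The masses decrease strictly with the height, and the angle between the faces `q₀ = q₁` and
`q₁ = q₂` of the configuration space is `π / 3`. -/
structure WideMasses (m : Fin 3 → ℝ) : Prop where
  pos : 0 < m 2
  lt₁ : m 2 < m 1
  lt₀ : m 1 < m 0
  wide : 4 * m 0 * m 2 = (m 0 + m 1) * (m 1 + m 2)

theorem wideMasses_of_sqrt {m : Fin 3 → ℝ} (hm2 : 0 < m 2) (hm21 : m 2 ≤ m 1) (hm10 : m 1 < m 0)
    (hmass : 2 * √(m 0) * √(m 2) = √(m 0 + m 1) * √(m 1 + m 2)) : WideMasses m := by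
  have hw : 4 * m 0 * m 2 = (m 0 + m 1) * (m 1 + m 2) := by
    have h := congrArg (· ^ 2) hmass
    simp only [mul_pow] at h
    rw [Real.sq_sqrt (by linarith), Real.sq_sqrt (by linarith), Real.sq_sqrt (by linarith),
      Real.sq_sqrt (by linarith)] at h
    linarith
  refine ⟨hm2, lt_of_le_of_ne hm21 fun h => ?_, hm10, hw⟩
  -- If the upper two masses were equal, the mass condition would reduce to `2 m₀ = m₀ + m₁`,
  -- against `m₁ < m₀`.
  rw [h] at hw
  nlinarith [mul_pos (h ▸ hm2) (sub_pos.2 hm10)]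

/-- The mass ratio `γ` of the lower two balls. -/
def lowRatio (m : Fin 3 → ℝ) : ℝ := massRatio (m 0) (m 1)

/-- The mass ratio `γ` of the upper two balls. -/
def upRatio (m : Fin 3 → ℝ) : ℝ := massRatio (m 1) (m 2)

namespace WideMasses

variable {m : Fin 3 → ℝ} (h : WideMasses m)
include h

theorem pos₁ : 0 < m 1 := h.pos.trans h.lt₁

theorem pos₀ : 0 < m 0 := h.pos₁.trans h.lt₀

theorem pos_all (i : Fin 3) : 0 < m i := by
  fin_cases i
  exacts [h.pos₀, h.pos₁, h.pos]

theorem ne_zero (i : Fin 3) : m i ≠ 0 := (h.pos_all i).ne'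

theorem sum_pos : 0 < m 0 + m 1 + m 2 := by linarith [h.pos, h.pos₁, h.pos₀]

theorem lowRatio_pos : 0 < lowRatio m :=
  div_pos (by linarith [h.lt₀]) (by linarith [h.pos₁, h.pos₀])

theorem lowRatio_lt_one : lowRatio m < 1 :=
  (div_lt_one (by linarith [h.pos₁, h.pos₀])).2 (by linarith [h.pos₁])

/-- The mass condition in the form in which it is used. It is equivalent to `(1 - upRatio m) * (1 +
lowRatio m) = 1`, the braid relation of the two reflections. -/
theorem upRatio_mul : upRatio m * (1 + lowRatio m) = lowRatio m := by
  have h0 := h.pos₀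
  have h1 := h.pos₁
  have h2 := h.pos
  have hw := h.wide
  have e0 : m 0 + m 1 ≠ 0 := by linarith
  have e1 : m 1 + m 2 ≠ 0 := by linarith
  unfold upRatio lowRatio massRatio
  field_simp
  linear_combination -hw

theorem upRatio_pos : 0 < upRatio m :=
  div_pos (by linarith [h.lt₁]) (by linarith [h.pos₁, h.pos])

theorem upRatio_lt_one : upRatio m < 1 :=
  (div_lt_one (by linarith [h.pos₁, h.pos])).2 (by linarith [h.pos])

end WideMasses

/-! ### Coordinates, free flight and collisions in terms of velocities and ball energies -/

theorem inv_coordMatrix {m : Fin 3 → ℝ} (hM : m 0 + m 1 + m 2 ≠ 0) :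
    (coordMatrix m)⁻¹ =
      !![1, 1, 1;
         1 - m 0 / (m 0 + m 1 + m 2), -(m 0 / (m 0 + m 1 + m 2)), -(m 0 / (m 0 + m 1 + m 2));
         m 2 / (m 0 + m 1 + m 2), m 2 / (m 0 + m 1 + m 2), m 2 / (m 0 + m 1 + m 2) - 1] := by
  refine Matrix.inv_eq_right_inv ?_
  ext i j
  fin_cases i <;> fin_cases j <;> simp [coordMatrix, Matrix.mul_apply, Fin.sum_univ_three] <;>
    field_simp <;> ring

/-- The energy of the ball `i`. -/
def ballEnergy (m : Fin 3 → ℝ) (x : Phase) (i : Fin 3) : ℝ :=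
  x.2 i ^ 2 / (2 * m i) + m i * x.1 i

theorem toXiEta_fst_zero {m : Fin 3 → ℝ} (hM : m 0 + m 1 + m 2 ≠ 0) (x : Phase) :
    (toXiEta m x).1 0 = hamiltonian m x := by
  simp [toXiEta, inv_coordMatrix hM, dotProduct, Fin.sum_univ_three, hamiltonian]

theorem toXiEta_fst_one {m : Fin 3 → ℝ} (hM : m 0 + m 1 + m 2 ≠ 0) (x : Phase) :
    (toXiEta m x).1 1 = ballEnergy m x 0 - m 0 / (m 0 + m 1 + m 2) * hamiltonian m x := by
  simp [toXiEta, inv_coordMatrix hM, dotProduct, Fin.sum_univ_three, hamiltonian,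
    ballEnergy]
  ring

theorem toXiEta_fst_two {m : Fin 3 → ℝ} (hM : m 0 + m 1 + m 2 ≠ 0) (x : Phase) :
    (toXiEta m x).1 2 = m 2 / (m 0 + m 1 + m 2) * hamiltonian m x - ballEnergy m x 2 := by
  simp [toXiEta, inv_coordMatrix hM, dotProduct, Fin.sum_univ_three, hamiltonian,
    ballEnergy]
  ring

theorem toXiEta_snd_one (m : Fin 3 → ℝ) (x : Phase) :
    (toXiEta m x).2 1 = vel m x 0 - vel m x 1 := by
  simp [toXiEta, coordMatrix, Matrix.mulVec, dotProduct, Fin.sum_univ_three, vel]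
  ring

theorem toXiEta_snd_two (m : Fin 3 → ℝ) (x : Phase) :
    (toXiEta m x).2 2 = vel m x 1 - vel m x 2 := by
  simp [toXiEta, coordMatrix, Matrix.mulVec, dotProduct, Fin.sum_univ_three, vel]
  ring

theorem hamiltonian_eq (m : Fin 3 → ℝ) (x : Phase) :
    hamiltonian m x = ballEnergy m x 0 + ballEnergy m x 1 + ballEnergy m x 2 := by
  simp [hamiltonian, ballEnergy, Fin.sum_univ_three]

theorem vel_flow {m : Fin 3 → ℝ} (hm : ∀ i, m i ≠ 0) (t : ℝ) (x : Phase) (i : Fin 3) :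
    vel m (flow m t x) i = vel m x i - t := by
  have := hm i
  simp only [vel, flow]
  field_simp

theorem pos_flow (m : Fin 3 → ℝ) (t : ℝ) (x : Phase) (i : Fin 3) :
    (flow m t x).1 i = x.1 i + t * vel m x i - t ^ 2 / 2 := by
  simp only [vel, flow]
  ring

theorem ballEnergy_eq {m : Fin 3 → ℝ} (hm : ∀ i, m i ≠ 0) (x : Phase) (i : Fin 3) :
    ballEnergy m x i = m i * (vel m x i ^ 2 / 2 + x.1 i) := by
  have := hm i
  simp only [vel, ballEnergy]
  field_simp

theorem ballEnergy_flow {m : Fin 3 → ℝ} (hm : ∀ i, m i ≠ 0) (t : ℝ) (x : Phase) (i : Fin 3) :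
    ballEnergy m (flow m t x) i = ballEnergy m x i := by
  rw [ballEnergy_eq hm, ballEnergy_eq hm, vel_flow hm, pos_flow]
  ring

theorem hamiltonian_flow {m : Fin 3 → ℝ} (hm : ∀ i, m i ≠ 0) (t : ℝ) (x : Phase) :
    hamiltonian m (flow m t x) = hamiltonian m x := by
  simp only [hamiltonian_eq, ballEnergy_flow hm]

theorem flow_zero (m : Fin 3 → ℝ) (x : Phase) : flow m 0 x = x := by
  ext i <;> simp [flow]

theorem flow_add {m : Fin 3 → ℝ} (hm : ∀ i, m i ≠ 0) (s t : ℝ) (x : Phase) :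
    flow m s (flow m t x) = flow m (t + s) x := by
  ext i
  · rw [pos_flow, pos_flow, pos_flow, vel_flow hm]
    ring
  · simp only [flow]
    ring

section Collision

variable {m : Fin 3 → ℝ} (hm : ∀ i, 0 < m i) (x : Phase)

theorem collision_fst (j : Fin 3) : (collision m j x).1 = x.1 := rfl

theorem vel_collision_zero_zero : vel m (collision m 0 x) 0 = -vel m x 0 := by
  simp [vel, collision, neg_div]

theorem vel_collision_zero_one : vel m (collision m 0 x) 1 = vel m x 1 := by
  simp [vel, collision]

theorem vel_collision_zero_two : vel m (collision m 0 x) 2 = vel m x 2 := by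
  simp [vel, collision]

include hm

theorem vel_collision_one_zero : vel m (collision m 1 x) 0 =
    lowRatio m * vel m x 0 + (1 - lowRatio m) * vel m x 1 := by
  have h0 := hm 0
  have h1 := hm 1
  simp [vel, collision, lowRatio, massRatio]
  field_simp
  ring

theorem vel_collision_one_one : vel m (collision m 1 x) 1 =
    (1 + lowRatio m) * vel m x 0 - lowRatio m * vel m x 1 := by
  have h0 := hm 0
  have h1 := hm 1
  simp [vel, collision, lowRatio, massRatio]
  field_simp
  ring

omit hm in
theorem vel_collision_one_two : vel m (collision m 1 x) 2 = vel m x 2 := by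
  simp [vel, collision]

omit hm in
theorem vel_collision_two_zero : vel m (collision m 2 x) 0 = vel m x 0 := by
  simp [vel, collision]

theorem vel_collision_two_one : vel m (collision m 2 x) 1 =
    upRatio m * vel m x 1 + (1 - upRatio m) * vel m x 2 := by
  have h0 := hm 1
  have h1 := hm 2
  simp [vel, collision, upRatio, massRatio]
  field_simp
  ring

theorem vel_collision_two_two : vel m (collision m 2 x) 2 =
    (1 + upRatio m) * vel m x 1 - upRatio m * vel m x 2 := by
  have h0 := hm 1
  have h1 := hm 2
  simp [vel, collision, upRatio, massRatio]
  field_simp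
  ring

end Collision

theorem hamiltonian_collision {m : Fin 3 → ℝ} (hm : ∀ i, 0 < m i) (j : Fin 3) (x : Phase) :
    hamiltonian m (collision m j x) = hamiltonian m x := by
  have hm' : ∀ i, m i ≠ 0 := fun i => (hm i).ne'
  have h0 := hm 0
  have h1 := hm 1
  have h2 := hm 2
  fin_cases j <;>
    simp only [hamiltonian_eq, ballEnergy_eq hm', collision_fst, Fin.zero_eta, Fin.mk_one,
      Fin.reduceFinMk, vel_collision_zero_zero, vel_collision_zero_one, vel_collision_zero_two,
      vel_collision_one_zero hm, vel_collision_one_one hm, vel_collision_one_two,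
      vel_collision_two_zero, vel_collision_two_one hm, vel_collision_two_two hm, lowRatio, upRatio,
      massRatio] <;>
    field_simp <;> ring

/-! ### The branches in the coordinates `(ξ, η)` -/

/-- The branch of `T` with the collision type `j` in the coordinates `(ξ, η)`. -/
def coordBranch (m : Fin 3 → ℝ) (j : Fin 3) (z : Phase) : Phase :=
  toXiEta m (branchMap m j (fromXiEta m z))

theorem differentiable_toXiEta (m : Fin 3 → ℝ) : Differentiable ℝ (toXiEta m) := by
  unfold toXiEta
  refine Differentiable.prodMk (differentiable_pi.2 fun i => ?_) (differentiable_pi.2 fun i => ?_)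
  all_goals
    simp only [Matrix.mulVec, dotProduct, Fin.sum_univ_three, div_eq_mul_inv]
    fun_prop

theorem differentiable_fromXiEta (m : Fin 3 → ℝ) : Differentiable ℝ (fromXiEta m) := by
  unfold fromXiEta
  refine Differentiable.prodMk (differentiable_pi.2 fun i => ?_) (differentiable_pi.2 fun i => ?_)
  all_goals
    simp only [Matrix.mulVec, dotProduct, Fin.sum_univ_three, div_eq_mul_inv]
    fun_prop

theorem differentiable_collision (m : Fin 3 → ℝ) (j : Fin 3) :
    Differentiable ℝ (collision m j) := by
  unfold collision
  refine Differentiable.prodMk (by fun_prop) (differentiable_pi.2 fun i => ?_)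
  fin_cases j <;> fin_cases i <;> simp <;> fun_prop

theorem differentiableAt_flow {m : Fin 3 → ℝ} {f : Phase → ℝ} {x : Phase}
    (hf : DifferentiableAt ℝ f x) : DifferentiableAt ℝ (fun x => flow m (f x) x) x := by
  unfold flow
  refine DifferentiableAt.prodMk (differentiableAt_pi.2 fun i => ?_)
    (differentiableAt_pi.2 fun i => ?_)
  · simp only [div_eq_mul_inv]
    fun_prop
  · fun_prop

/-- The points at which the branch of `T` with the collision type `j` is smooth. -/
def Regular (m : Fin 3 → ℝ) (j : Fin 3) (x : Phase) : Prop :=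
  ![0 < vel m x 0 ^ 2 + 2 * x.1 0, vel m x 1 < vel m x 0, vel m x 2 < vel m x 1] j

theorem differentiableAt_hitTime {m : Fin 3 → ℝ} {j : Fin 3} {x : Phase} (hx : Regular m j x) :
    DifferentiableAt ℝ (hitTime m j) x := by
  unfold hitTime
  have hv : ∀ i, DifferentiableAt ℝ (fun x => vel m x i) x := fun i => by
    simp only [vel, div_eq_mul_inv]
    fun_prop
  have hq : ∀ i, DifferentiableAt ℝ (fun x : Phase => x.1 i) x := fun i => by fun_prop
  fin_cases j
  · simp [Regular] at hx ⊢
    exact (hv 0).add ((((hv 0).pow 2).add ((hq 0).const_mul 2)).sqrt hx.ne')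
  · simp [Regular] at hx ⊢
    have h1 := (hq 1).fun_sub (hq 0)
    have h2 := (hv 0).fun_sub (hv 1)
    exact h1.fun_mul (h2.fun_inv (sub_pos.2 hx).ne')
  · simp [Regular] at hx ⊢
    have h1 := (hq 2).fun_sub (hq 1)
    have h2 := (hv 1).fun_sub (hv 2)
    exact h1.fun_mul (h2.fun_inv (sub_pos.2 hx).ne')

theorem differentiableAt_branchMap {m : Fin 3 → ℝ} {j : Fin 3} {x : Phase}
    (hx : Regular m j x) : DifferentiableAt ℝ (branchMap m j) x :=
  (differentiable_collision m j _).comp x (differentiableAt_flow (differentiableAt_hitTime hx))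

theorem differentiableAt_coordBranch {m : Fin 3 → ℝ} {j : Fin 3} {z : Phase}
    (hx : Regular m j (fromXiEta m z)) : DifferentiableAt ℝ (coordBranch m j) z :=
  (differentiable_toXiEta m _).comp z
    ((differentiableAt_branchMap hx).comp z (differentiable_fromXiEta m z))

/-- Free flight does not change relative velocities, so balls about to collide approach each other
from the start; at the floor, `v₀² + 2 q₀` is the square of the nonzero landing velocity. -/
theorem Step.regular {m : Fin 3 → ℝ} (hm : ∀ i, m i ≠ 0) {c : ℝ} {j : Fin 3} {x y : Phase}
    (h : Step m c j x y) : Regular m j x := by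
  obtain ⟨τ, -, -, -, ⟨-, -, h0, h1⟩, -⟩ := h
  fin_cases j
  · simp [gap, gapVel, Regular, vel_flow hm, pos_flow] at h0 h1 ⊢
    nlinarith [pow_pos (sub_pos.2 h1) 2]
  · simp [gap, gapVel, Regular, vel_flow hm, pos_flow] at h0 h1 ⊢
    linarith
  · simp [gap, gapVel, Regular, vel_flow hm, pos_flow] at h0 h1 ⊢
    linarith

theorem Step.eq_branchMap {m : Fin 3 → ℝ} (hm : ∀ i, m i ≠ 0) {c : ℝ} {j : Fin 3} {x y : Phase}
    (h : Step m c j x y) : y = branchMap m j x := by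
  obtain ⟨τ, -, -, -, hτ, rfl⟩ := h
  rw [branchMap, ← eq_hitTime hm hτ]

theorem differentiableAt_branchIter {m : Fin 3 → ℝ} (hm : ∀ i, m i ≠ 0) {c : ℝ} :
    ∀ {w : List (Fin 3)} {x : Phase}, IsBranch m c w x → DifferentiableAt ℝ (branchIter m w) x
  | [], _, _ => differentiableAt_id
  | j :: w, x, ⟨y, hy, hw⟩ => by
    rw [hy.eq_branchMap hm] at hw
    exact (differentiableAt_branchIter hm hw).comp x (differentiableAt_branchMap (hy.regular hm))

theorem derivBranch_cons {m : Fin 3 → ℝ} (hm : ∀ i, m i ≠ 0) (hM : m 0 + m 1 + m 2 ≠ 0) {c : ℝ}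
    {j : Fin 3} {w : List (Fin 3)} {x y : Phase} (hy : Step m c j x y) (hw : IsBranch m c w y) :
    derivBranch m (j :: w) x =
      (derivBranch m w y).comp (fderiv ℝ (coordBranch m j) (toXiEta m x)) := by
  have hxy := hy.eq_branchMap hm
  have hd : DifferentiableAt ℝ (coordBranch m j) (toXiEta m x) :=
    differentiableAt_coordBranch (by rw [fromXiEta_toXiEta hm hM]; exact hy.regular hm)
  have hc : coordBranch m j (toXiEta m x) = toXiEta m y := by
    rw [coordBranch, fromXiEta_toXiEta hm hM, hxy]
  have hd' : DifferentiableAt ℝ (toXiEta m ∘ branchIter m w ∘ fromXiEta m)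
      (coordBranch m j (toXiEta m x)) := by
    rw [hc]
    refine (differentiable_toXiEta m _).comp _ (DifferentiableAt.comp _ ?_
      (differentiable_fromXiEta m _))
    rw [fromXiEta_toXiEta hm hM]
    exact differentiableAt_branchIter hm hw
  have he : toXiEta m ∘ branchIter m (j :: w) ∘ fromXiEta m =
      (toXiEta m ∘ branchIter m w ∘ fromXiEta m) ∘ coordBranch m j := by
    funext z
    simp [branchIter, coordBranch, fromXiEta_toXiEta hm hM]
  rw [derivBranch, he, fderiv_comp _ hd' hd, hc, derivBranch]

theorem derivBranch_nil {m : Fin 3 → ℝ} (hm : ∀ i, m i ≠ 0) (hM : m 0 + m 1 + m 2 ≠ 0)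
    (x : Phase) : derivBranch m [] x = ContinuousLinearMap.id ℝ Phase := by
  have he : toXiEta m ∘ branchIter m [] ∘ fromXiEta m = id := by
    funext z
    simp [branchIter, toXiEta_fromXiEta hm hM]
  rw [derivBranch, he, fderiv_id]

section Formulas

variable {m : Fin 3 → ℝ} (hm : ∀ i, 0 < m i)
include hm

theorem hamiltonian_branchMap (j : Fin 3) (x : Phase) :
    hamiltonian m (branchMap m j x) = hamiltonian m x := by
  rw [branchMap, hamiltonian_collision hm, hamiltonian_flow fun i => (hm i).ne']

/-- A floor collision preserves the energy of each ball, hence `ξ`. The lowest ball lands with the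
speed `√(2 h₀ / m₀)`, and the reflection adds twice this speed to `v₀ - v₁`. -/
theorem toXiEta_branchMap_zero (x : Phase) :
    (toXiEta m (branchMap m 0 x)).1 = (toXiEta m x).1 ∧
    (toXiEta m (branchMap m 0 x)).2 1 =
      (toXiEta m x).2 1 + 2 * √(2 * ballEnergy m x 0 / m 0) ∧
    (toXiEta m (branchMap m 0 x)).2 2 = (toXiEta m x).2 2 := by
  have hm' : ∀ i, m i ≠ 0 := fun i => (hm i).ne'
  have hM : m 0 + m 1 + m 2 ≠ 0 := by linarith [hm 0, hm 1, hm 2]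
  have hb : ∀ i, ballEnergy m (branchMap m 0 x) i = ballEnergy m x i := fun i => by
    rw [branchMap, ← ballEnergy_flow hm' (hitTime m 0 x) x i, ballEnergy_eq hm', ballEnergy_eq hm',
      collision_fst]
    fin_cases i <;> simp [vel_collision_zero_zero, vel_collision_zero_one, vel_collision_zero_two]
  have hs : 2 * ballEnergy m x 0 / m 0 = vel m x 0 ^ 2 + 2 * x.1 0 := by
    have := hm' 0
    rw [ballEnergy_eq hm']
    field_simp
  refine ⟨?_, ?_, ?_⟩
  · ext i
    fin_cases i <;> simp [toXiEta_fst_zero hM, toXiEta_fst_one hM, toXiEta_fst_two hM, hb,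
      hamiltonian_eq]
  · rw [toXiEta_snd_one, toXiEta_snd_one, branchMap, vel_collision_zero_zero,
      vel_collision_zero_one, vel_flow hm', vel_flow hm', hs]
    simp [hitTime]
    ring
  · rw [toXiEta_snd_two, toXiEta_snd_two, branchMap, vel_collision_zero_one,
      vel_collision_zero_two, vel_flow hm', vel_flow hm']
    ring

/-- The upper ball does not take part, so `ξ₂` is kept. The map is linear except for one term
quadratic in the approach velocity `η₁`; this term is the source of expansion. -/
theorem toXiEta_branchMap_one {x : Phase} (hx : vel m x 0 ≠ vel m x 1) :
    (toXiEta m (branchMap m 1 x)).1 0 = (toXiEta m x).1 0 ∧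
    (toXiEta m (branchMap m 1 x)).1 1 =
      -(toXiEta m x).1 1 + (1 + lowRatio m) * (toXiEta m x).1 2
        - m 0 * m 1 / (m 0 + m 1) * lowRatio m * (toXiEta m x).2 1 ^ 2 ∧
    (toXiEta m (branchMap m 1 x)).1 2 = (toXiEta m x).1 2 ∧
    (toXiEta m (branchMap m 1 x)).2 1 = -(toXiEta m x).2 1 ∧
    (toXiEta m (branchMap m 1 x)).2 2 =
      (toXiEta m x).2 2 + (1 + lowRatio m) * (toXiEta m x).2 1 := by
  have hm' : ∀ i, m i ≠ 0 := fun i => (hm i).ne'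
  have hM : m 0 + m 1 + m 2 ≠ 0 := by linarith [hm 0, hm 1, hm 2]
  have h0 := hm 0
  have h1 := hm 1
  have h2 := hm 2
  have hx' : vel m x 0 - vel m x 1 ≠ 0 := sub_ne_zero.2 hx
  refine ⟨?_, ?_, ?_, ?_, ?_⟩
  · rw [toXiEta_fst_zero hM, toXiEta_fst_zero hM, hamiltonian_branchMap hm]
  · simp only [toXiEta_fst_one hM, toXiEta_fst_two hM, toXiEta_snd_one, hamiltonian_branchMap hm]
    simp only [hamiltonian_eq, ballEnergy_eq hm', branchMap, collision_fst,
      vel_collision_one_zero hm, vel_flow hm', pos_flow]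
    simp only [hitTime, lowRatio, massRatio, Matrix.cons_val_one, Matrix.cons_val_zero]
    field_simp
    ring
  · simp only [toXiEta_fst_two hM, hamiltonian_branchMap hm]
    rw [ballEnergy_eq hm', branchMap, collision_fst, vel_collision_one_two, ← ballEnergy_eq hm',
      ballEnergy_flow hm']
  · rw [toXiEta_snd_one, toXiEta_snd_one, branchMap, vel_collision_one_zero hm,
      vel_collision_one_one hm, vel_flow hm', vel_flow hm']
    ring
  · rw [toXiEta_snd_two, toXiEta_snd_two, toXiEta_snd_one, branchMap, vel_collision_one_one hm,
      vel_collision_one_two, vel_flow hm', vel_flow hm', vel_flow hm']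
    ring

theorem toXiEta_branchMap_two {x : Phase} (hx : vel m x 1 ≠ vel m x 2) :
    (toXiEta m (branchMap m 2 x)).1 0 = (toXiEta m x).1 0 ∧
    (toXiEta m (branchMap m 2 x)).1 1 = (toXiEta m x).1 1 ∧
    (toXiEta m (branchMap m 2 x)).1 2 =
      -(toXiEta m x).1 2 + (1 - upRatio m) * (toXiEta m x).1 1
        - m 1 * m 2 / (m 1 + m 2) * upRatio m * (toXiEta m x).2 2 ^ 2 ∧
    (toXiEta m (branchMap m 2 x)).2 1 =
      (toXiEta m x).2 1 + (1 - upRatio m) * (toXiEta m x).2 2 ∧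
    (toXiEta m (branchMap m 2 x)).2 2 = -(toXiEta m x).2 2 := by
  have hm' : ∀ i, m i ≠ 0 := fun i => (hm i).ne'
  have hM : m 0 + m 1 + m 2 ≠ 0 := by linarith [hm 0, hm 1, hm 2]
  have h0 := hm 0
  have h1 := hm 1
  have h2 := hm 2
  have hx' : vel m x 1 - vel m x 2 ≠ 0 := sub_ne_zero.2 hx
  refine ⟨?_, ?_, ?_, ?_, ?_⟩
  · rw [toXiEta_fst_zero hM, toXiEta_fst_zero hM, hamiltonian_branchMap hm]
  · simp only [toXiEta_fst_one hM, hamiltonian_branchMap hm]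
    rw [ballEnergy_eq hm', branchMap, collision_fst, vel_collision_two_zero, ← ballEnergy_eq hm',
      ballEnergy_flow hm']
  · simp only [toXiEta_fst_one hM, toXiEta_fst_two hM, toXiEta_snd_two, hamiltonian_branchMap hm]
    simp only [hamiltonian_eq, ballEnergy_eq hm', branchMap, collision_fst,
      vel_collision_two_two hm, vel_flow hm', pos_flow]
    simp only [hitTime, upRatio, massRatio, Matrix.cons_val]
    field_simp
    ring
  · rw [toXiEta_snd_one, toXiEta_snd_one, toXiEta_snd_two, branchMap, vel_collision_two_zero,
      vel_collision_two_one hm, vel_flow hm', vel_flow hm', vel_flow hm']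
    ring
  · rw [toXiEta_snd_two, toXiEta_snd_two, branchMap, vel_collision_two_one hm,
      vel_collision_two_two hm, vel_flow hm', vel_flow hm']
    ring

end Formulas

/-! ### The derivative along a branch -/

open Topology in
-- Reduces each component of the derivative to a one-variable derivative of a formula that need only
-- be valid near the point.
theorem apply_fderiv_eq_of_hasLineDerivAt {G : Phase → Phase} {z v : Phase} {f : Phase → ℝ}
    {a : ℝ} (hG : DifferentiableAt ℝ G z) (ℓ : Phase →L[ℝ] ℝ)
    (he : ∀ᶠ z' in 𝓝 z, ℓ (G z') = f z') (hf : HasLineDerivAt ℝ f a z v) :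
    ℓ (fderiv ℝ G z v) = a := by
  have h1 : HasFDerivAt (fun z => ℓ (G z)) (ℓ.comp (fderiv ℝ G z)) z :=
    ℓ.hasFDerivAt.comp z hG.hasFDerivAt
  exact (h1.hasLineDerivAt v).unique (hf.congr_of_eventuallyEq he)

/-- The coordinate `δξᵢ`. -/
def xiCoord (i : Fin 3) : Phase →L[ℝ] ℝ :=
  (ContinuousLinearMap.proj i).comp (ContinuousLinearMap.fst ℝ (Fin 3 → ℝ) (Fin 3 → ℝ))

/-- The coordinate `δηᵢ`. -/
def etaCoord (i : Fin 3) : Phase →L[ℝ] ℝ :=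
  (ContinuousLinearMap.proj i).comp (ContinuousLinearMap.snd ℝ (Fin 3 → ℝ) (Fin 3 → ℝ))

theorem hasLineDerivAt_xi (i : Fin 3) (z v : Phase) :
    HasLineDerivAt ℝ (fun z : Phase => z.1 i) (v.1 i) z v :=
  (xiCoord i).hasFDerivAt.hasLineDerivAt v

theorem hasLineDerivAt_eta (i : Fin 3) (z v : Phase) :
    HasLineDerivAt ℝ (fun z : Phase => z.2 i) (v.2 i) z v :=
  (etaCoord i).hasFDerivAt.hasLineDerivAt v

section StepDeriv

variable {m : Fin 3 → ℝ} (h : WideMasses m) {c : ℝ} {x y : Phase}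
include h

/-- The landing speed depends on `h₀ = ξ₁ + m₀ / (m₀ + m₁ + m₂) ξ₀`. On `δξ₀ = 0` its variation is a
positive multiple of `δξ₁`. -/
theorem fderiv_coordBranch_zero (hy : Step m c 0 x y) : ∃ k : ℝ, 0 < k ∧ ∀ v : Phase,
    v.1 0 = 0 → (fderiv ℝ (coordBranch m 0) (toXiEta m x) v).1 = v.1 ∧
      (fderiv ℝ (coordBranch m 0) (toXiEta m x) v).2 1 = v.2 1 + k * v.1 1 ∧
      (fderiv ℝ (coordBranch m 0) (toXiEta m x) v).2 2 = v.2 2 := by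
  have hm := h.ne_zero
  have hM := h.sum_pos.ne'
  have hr := hy.regular hm
  have hx := fromXiEta_toXiEta hm hM x
  have hd : DifferentiableAt ℝ (coordBranch m 0) (toXiEta m x) :=
    differentiableAt_coordBranch (by rwa [hx])
  have hF : ∀ z, (coordBranch m 0 z).1 = z.1 ∧
      (coordBranch m 0 z).2 1 =
        z.2 1 + 2 * √(2 * (z.1 1 + m 0 / (m 0 + m 1 + m 2) * z.1 0) / m 0) ∧
      (coordBranch m 0 z).2 2 = z.2 2 := fun z => by
    have := toXiEta_branchMap_zero h.pos_all (fromXiEta m z)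
    have e1 := toXiEta_fst_one hM (fromXiEta m z)
    have e0 := toXiEta_fst_zero hM (fromXiEta m z)
    rw [toXiEta_fromXiEta hm hM] at this e0 e1
    rw [show ballEnergy m (fromXiEta m z) 0 = z.1 1 + m 0 / (m 0 + m 1 + m 2) * z.1 0 by
      rw [e0, e1]; ring] at this
    exact this
  set z := toXiEta m x with hz
  have hpos : 0 < 2 * (z.1 1 + m 0 / (m 0 + m 1 + m 2) * z.1 0) / m 0 := by
    have e1 := toXiEta_fst_one hM x
    have e0 := toXiEta_fst_zero hM x
    have hb : z.1 1 + m 0 / (m 0 + m 1 + m 2) * z.1 0 = ballEnergy m x 0 := by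
      rw [hz, e0, e1]
      ring
    rw [hb, ballEnergy_eq hm]
    have : 0 < vel m x 0 ^ 2 + 2 * x.1 0 := hr
    have h0 := h.pos₀
    have e : 2 * (m 0 * (vel m x 0 ^ 2 / 2 + x.1 0)) / m 0 = vel m x 0 ^ 2 + 2 * x.1 0 := by
      field_simp
    rwa [e]
  have h0 := h.pos₀
  have hk : 0 < √(2 * (z.1 1 + m 0 / (m 0 + m 1 + m 2) * z.1 0) / m 0) := Real.sqrt_pos.2 hpos
  refine ⟨2 / m 0 / √(2 * (z.1 1 + m 0 / (m 0 + m 1 + m 2) * z.1 0) / m 0), by positivity,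
    fun v hv => ⟨?_, ?_, ?_⟩⟩
  · ext i
    exact apply_fderiv_eq_of_hasLineDerivAt hd (xiCoord i)
      (.of_forall fun z => congrFun (hF z).1 i) (hasLineDerivAt_xi i z v)
  · refine apply_fderiv_eq_of_hasLineDerivAt hd (etaCoord 1) (.of_forall fun z => (hF z).2.1) ?_
    have hl : HasLineDerivAt ℝ
        (fun z : Phase => 2 * (z.1 1 + m 0 / (m 0 + m 1 + m 2) * z.1 0) / m 0)
        (2 * (v.1 1 + m 0 / (m 0 + m 1 + m 2) * v.1 0) / m 0) z v :=
      (((hasLineDerivAt_xi 1 z v).add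
        ((hasLineDerivAt_xi 0 z v).const_mul _)).const_mul 2).div_const _
    have hs := HasDerivAt.sqrt hl (by simpa using hpos.ne')
    have := HasDerivAt.add (hasLineDerivAt_eta 1 z v) (hs.const_mul 2)
    refine HasDerivAt.congr_deriv this ?_
    simp only [hv, zero_smul, add_zero]
    field_simp
    ring
  · exact apply_fderiv_eq_of_hasLineDerivAt hd (etaCoord 2) (.of_forall fun z => (hF z).2.2)
      (hasLineDerivAt_eta 2 z v)

/-- The constant is `k = 2 μ γ η₁` with the reduced mass `μ`: positive because the lower ball is
heavier (`γ > 0`) and the balls approach (`η₁ > 0`). -/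
theorem fderiv_coordBranch_one (hy : Step m c 1 x y) : ∃ k : ℝ, 0 < k ∧ ∀ v : Phase,
    (fderiv ℝ (coordBranch m 1) (toXiEta m x) v).1 0 = v.1 0 ∧
      (fderiv ℝ (coordBranch m 1) (toXiEta m x) v).1 1 =
        -v.1 1 + (1 + lowRatio m) * v.1 2 - k * v.2 1 ∧
      (fderiv ℝ (coordBranch m 1) (toXiEta m x) v).1 2 = v.1 2 ∧
      (fderiv ℝ (coordBranch m 1) (toXiEta m x) v).2 1 = -v.2 1 ∧
      (fderiv ℝ (coordBranch m 1) (toXiEta m x) v).2 2 = v.2 2 + (1 + lowRatio m) * v.2 1 := by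
  have hm := h.ne_zero
  have hM := h.sum_pos.ne'
  have hr := hy.regular hm
  have hx := fromXiEta_toXiEta hm hM x
  have hd : DifferentiableAt ℝ (coordBranch m 1) (toXiEta m x) :=
    differentiableAt_coordBranch (by rwa [hx])
  set z := toXiEta m x with hz
  have hpos : 0 < z.2 1 := by
    rw [hz, toXiEta_snd_one]
    exact sub_pos.2 hr
  have hF : ∀ᶠ z in nhds z, (coordBranch m 1 z).1 0 = z.1 0 ∧
      (coordBranch m 1 z).1 1 = -z.1 1 + (1 + lowRatio m) * z.1 2
        - m 0 * m 1 / (m 0 + m 1) * lowRatio m * z.2 1 ^ 2 ∧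
      (coordBranch m 1 z).1 2 = z.1 2 ∧
      (coordBranch m 1 z).2 1 = -z.2 1 ∧
      (coordBranch m 1 z).2 2 = z.2 2 + (1 + lowRatio m) * z.2 1 := by
    have hc : ContinuousAt (fun z : Phase => z.2 1) z := by fun_prop
    filter_upwards [hc.eventually (lt_mem_nhds hpos)] with z hz1
    have hne : vel m (fromXiEta m z) 0 ≠ vel m (fromXiEta m z) 1 := by
      have := toXiEta_snd_one m (fromXiEta m z)
      rw [toXiEta_fromXiEta hm hM] at this
      exact fun h => by simp [h] at this; linarith
    have := toXiEta_branchMap_one h.pos_all hne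
    rwa [toXiEta_fromXiEta hm hM] at this
  have h0 := h.pos₀
  have h1 := h.pos₁
  have hg := h.lowRatio_pos
  refine ⟨2 * (m 0 * m 1 / (m 0 + m 1) * lowRatio m * z.2 1), by positivity,
    fun v => ⟨?_, ?_, ?_, ?_, ?_⟩⟩
  · exact apply_fderiv_eq_of_hasLineDerivAt hd (xiCoord 0) (hF.mono fun z hz => hz.1)
      (hasLineDerivAt_xi 0 z v)
  · refine apply_fderiv_eq_of_hasLineDerivAt hd (xiCoord 1) (hF.mono fun z hz => hz.2.1) ?_
    have := ((HasDerivAt.neg (hasLineDerivAt_xi 1 z v)).add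
      (HasDerivAt.const_mul (1 + lowRatio m) (hasLineDerivAt_xi 2 z v))).sub
      (HasDerivAt.const_mul (m 0 * m 1 / (m 0 + m 1) * lowRatio m)
        (HasDerivAt.pow (hasLineDerivAt_eta 1 z v) 2))
    refine HasDerivAt.congr_deriv this ?_
    simp
    ring
  · exact apply_fderiv_eq_of_hasLineDerivAt hd (xiCoord 2) (hF.mono fun z hz => hz.2.2.1)
      (hasLineDerivAt_xi 2 z v)
  · exact apply_fderiv_eq_of_hasLineDerivAt hd (etaCoord 1) (hF.mono fun z hz => hz.2.2.2.1)
      (HasDerivAt.neg (hasLineDerivAt_eta 1 z v))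
  · exact apply_fderiv_eq_of_hasLineDerivAt hd (etaCoord 2) (hF.mono fun z hz => hz.2.2.2.2)
      (HasDerivAt.add (hasLineDerivAt_eta 2 z v)
        (HasDerivAt.const_mul (1 + lowRatio m) (hasLineDerivAt_eta 1 z v)))

theorem fderiv_coordBranch_two (hy : Step m c 2 x y) : ∃ k : ℝ, 0 < k ∧ ∀ v : Phase,
    (fderiv ℝ (coordBranch m 2) (toXiEta m x) v).1 0 = v.1 0 ∧
      (fderiv ℝ (coordBranch m 2) (toXiEta m x) v).1 1 = v.1 1 ∧
      (fderiv ℝ (coordBranch m 2) (toXiEta m x) v).1 2 =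
        -v.1 2 + (1 - upRatio m) * v.1 1 - k * v.2 2 ∧
      (fderiv ℝ (coordBranch m 2) (toXiEta m x) v).2 1 = v.2 1 + (1 - upRatio m) * v.2 2 ∧
      (fderiv ℝ (coordBranch m 2) (toXiEta m x) v).2 2 = -v.2 2 := by
  have hm := h.ne_zero
  have hM := h.sum_pos.ne'
  have hr := hy.regular hm
  have hx := fromXiEta_toXiEta hm hM x
  have hd : DifferentiableAt ℝ (coordBranch m 2) (toXiEta m x) :=
    differentiableAt_coordBranch (by rwa [hx])
  set z := toXiEta m x with hz
  have hpos : 0 < z.2 2 := by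
    rw [hz, toXiEta_snd_two]
    exact sub_pos.2 hr
  have hF : ∀ᶠ z in nhds z, (coordBranch m 2 z).1 0 = z.1 0 ∧
      (coordBranch m 2 z).1 1 = z.1 1 ∧
      (coordBranch m 2 z).1 2 = -z.1 2 + (1 - upRatio m) * z.1 1
        - m 1 * m 2 / (m 1 + m 2) * upRatio m * z.2 2 ^ 2 ∧
      (coordBranch m 2 z).2 1 = z.2 1 + (1 - upRatio m) * z.2 2 ∧
      (coordBranch m 2 z).2 2 = -z.2 2 := by
    have hc : ContinuousAt (fun z : Phase => z.2 2) z := by fun_prop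
    filter_upwards [hc.eventually (lt_mem_nhds hpos)] with z hz1
    have hne : vel m (fromXiEta m z) 1 ≠ vel m (fromXiEta m z) 2 := by
      have := toXiEta_snd_two m (fromXiEta m z)
      rw [toXiEta_fromXiEta hm hM] at this
      exact fun h => by simp [h] at this; linarith
    have := toXiEta_branchMap_two h.pos_all hne
    rwa [toXiEta_fromXiEta hm hM] at this
  have h0 := h.pos
  have h1 := h.pos₁
  have hg := h.upRatio_pos
  refine ⟨2 * (m 1 * m 2 / (m 1 + m 2) * upRatio m * z.2 2), by positivity,
    fun v => ⟨?_, ?_, ?_, ?_, ?_⟩⟩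
  · exact apply_fderiv_eq_of_hasLineDerivAt hd (xiCoord 0) (hF.mono fun z hz => hz.1)
      (hasLineDerivAt_xi 0 z v)
  · exact apply_fderiv_eq_of_hasLineDerivAt hd (xiCoord 1) (hF.mono fun z hz => hz.2.1)
      (hasLineDerivAt_xi 1 z v)
  · refine apply_fderiv_eq_of_hasLineDerivAt hd (xiCoord 2) (hF.mono fun z hz => hz.2.2.1) ?_
    have := ((HasDerivAt.neg (hasLineDerivAt_xi 2 z v)).add
      (HasDerivAt.const_mul (1 - upRatio m) (hasLineDerivAt_xi 1 z v))).sub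
      (HasDerivAt.const_mul (m 1 * m 2 / (m 1 + m 2) * upRatio m)
        (HasDerivAt.pow (hasLineDerivAt_eta 2 z v) 2))
    refine HasDerivAt.congr_deriv this ?_
    simp
    ring
  · exact apply_fderiv_eq_of_hasLineDerivAt hd (etaCoord 1) (hF.mono fun z hz => hz.2.2.2.1)
      (HasDerivAt.add (hasLineDerivAt_eta 1 z v)
        (HasDerivAt.const_mul (1 - upRatio m) (hasLineDerivAt_eta 2 z v)))
  · exact apply_fderiv_eq_of_hasLineDerivAt hd (etaCoord 2) (hF.mono fun z hz => hz.2.2.2.2)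
      (HasDerivAt.neg (hasLineDerivAt_eta 2 z v))

end StepDeriv

/-! ### Strict monotonicity

In suitable linear coordinates the ball-ball collisions permute three labels. A branch along which
the floor is hit with each of the labels is strictly monotone. -/

/-- The permutation of the labels by a collision of type `j`. -/
def mirror (j : Fin 3) : Equiv.Perm (Fin 3) := ![1, Equiv.swap 0 1, Equiv.swap 1 2] j

/-- The labels (that is, the initial positions in the order of the labels) which hit the floor along
a branch. -/
def hits : List (Fin 3) → Set (Fin 3)
  | [] => ∅
  | j :: w => {l | (j = 0 ∧ l = 0) ∨ mirror j l ∈ hits w}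

/-- Only a collision of the upper two balls can move a label out of the top position. -/
theorem two_notMem_hits : ∀ {w : List (Fin 3)}, 2 ∉ w → (2 : Fin 3) ∉ hits w
  | [], _ => id
  | j :: w, h => by
    simp only [List.mem_cons, not_or] at h
    rintro (⟨-, h0⟩ | h0)
    · exact absurd h0 (by decide)
    · refine two_notMem_hits h.2 ?_
      have : mirror j 2 = 2 := by
        revert h
        fin_cases j <;> simp [mirror, Equiv.swap_apply_def]
      rwa [this] at h0

theorem notMem_hits_of_ne_zero : ∀ {w : List (Fin 3)}, 1 ∉ w → ∀ {l : Fin 3}, l ≠ 0 → l ∉ hits w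
  | [], _, _, _ => id
  | j :: w, h, l, hl => by
    simp only [List.mem_cons, not_or] at h
    rintro (⟨-, h0⟩ | h0)
    · exact hl h0
    · refine notMem_hits_of_ne_zero h.2 ?_ h0
      have := h.1
      revert hl this
      fin_cases j <;> fin_cases l <;> simp [mirror, Equiv.swap_apply_def]

theorem Q_eq {v : Phase} (hv : v.1 0 = 0) : Q v = v.1 1 * v.2 1 + v.1 2 * v.2 2 := by
  simp [Q, Fin.sum_univ_three, hv]

/-- The coordinates of `δξ` which are permuted by the ball-ball collisions. -/
def zeta (m : Fin 3 → ℝ) (v : Phase) : Fin 3 → ℝ :=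
  ![(1 - upRatio m) * v.1 1, v.1 2 - (1 - upRatio m) * v.1 1, -v.1 2]

theorem WideMasses.one_sub_upRatio_mul {m : Fin 3 → ℝ} (h : WideMasses m) :
    (1 - upRatio m) * (1 + lowRatio m) = 1 := by
  linear_combination -h.upRatio_mul

/-- Induction along the branch. Each step adds `k` times a square to `Q`, so in the case of equality
every square vanishes. Vanishing `δη₁` or `δη₂` removes the nonlinear contribution, so the later
constraints can be pulled back: `δη` constraints unchanged, `zeta` constraints through the
transposition `mirror j`. A floor collision contributes the constraint that the lowest coordinate of
`zeta` is zero. -/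
theorem Q_derivBranch {m : Fin 3 → ℝ} (h : WideMasses m) {c : ℝ} :
    ∀ {w : List (Fin 3)} {x : Phase}, IsBranch m c w x → ∀ {v : Phase}, v.1 0 = 0 →
      Q v ≤ Q (derivBranch m w x v) ∧ (Q (derivBranch m w x v) ≤ Q v →
        (1 ∈ w → v.2 1 = 0) ∧ (2 ∈ w → v.2 2 = 0) ∧ ∀ l ∈ hits w, zeta m v l = 0)
  | [], x, _, v, hv => by
    simp [derivBranch_nil h.ne_zero h.sum_pos.ne', hits]
  | j :: w, x, ⟨y, hy, hw⟩, v, hv => by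
    rw [derivBranch_cons h.ne_zero h.sum_pos.ne' hy hw, ContinuousLinearMap.comp_apply]
    set v' := fderiv ℝ (coordBranch m j) (toXiEta m x) v with hv'
    have hj : j = 0 ∨ j = 1 ∨ j = 2 := by
      fin_cases j <;> simp
    rcases hj with rfl | rfl | rfl
    · obtain ⟨k, hk, hD⟩ := fderiv_coordBranch_zero h hy
      obtain ⟨h1, h2, h3⟩ := hD v hv
      rw [← hv'] at h1 h2 h3
      have hv0 : v'.1 0 = 0 := by rw [h1, hv]
      obtain ⟨hQ, hE⟩ := Q_derivBranch h hw hv0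
      have hq : Q v' = Q v + k * v.1 1 ^ 2 := by
        rw [Q_eq hv, Q_eq hv0, h1, h2, h3]
        ring
      have hs : 0 ≤ k * v.1 1 ^ 2 := by positivity
      refine ⟨by linarith, fun hle => ?_⟩
      obtain ⟨hE1, hE2, hE3⟩ := hE (by linarith)
      have hz : v.1 1 = 0 := by
        have : k * v.1 1 ^ 2 = 0 := by linarith
        simpa [hk.ne'] using this
      rw [h2, hz, mul_zero, add_zero] at hE1
      rw [h3] at hE2
      refine ⟨by simpa using hE1, by simpa using hE2, ?_⟩
      rintro l (⟨-, rfl⟩ | hl)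
      · simp [zeta, hz]
      · have := hE3 _ hl
        simpa [zeta, h1, mirror] using this
    · obtain ⟨k, hk, hD⟩ := fderiv_coordBranch_one h hy
      obtain ⟨h0, h1, h2, h3, h4⟩ := hD v
      rw [← hv'] at h0 h1 h2 h3 h4
      have hv0 : v'.1 0 = 0 := by rw [h0, hv]
      obtain ⟨hQ, hE⟩ := Q_derivBranch h hw hv0
      have hq : Q v' = Q v + k * v.2 1 ^ 2 := by
        rw [Q_eq hv, Q_eq hv0, h1, h2, h3, h4]
        ring
      have hs : 0 ≤ k * v.2 1 ^ 2 := by positivity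
      refine ⟨by linarith, fun hle => ?_⟩
      obtain ⟨hE1, hE2, hE3⟩ := hE (by linarith)
      have hz : v.2 1 = 0 := by
        have : k * v.2 1 ^ 2 = 0 := by linarith
        simpa [hk.ne'] using this
      rw [h4, hz, mul_zero, add_zero] at hE2
      refine ⟨fun _ => hz, by simpa using hE2, ?_⟩
      rintro l (⟨h10, -⟩ | hl)
      · exact absurd h10 (by decide)
      -- The mass condition enters here: it makes the reflection a transposition of the coordinates
      -- of `zeta`.
      · have he := h.one_sub_upRatio_mul
        have hl' := hE3 _ hl
        rw [← hl']
        fin_cases l <;> simp [zeta, h1, h2, hz, mirror, Equiv.swap_apply_def] <;>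
          first
          | linear_combination v.1 2 * he
          | linear_combination -v.1 2 * he
    · obtain ⟨k, hk, hD⟩ := fderiv_coordBranch_two h hy
      obtain ⟨h0, h1, h2, h3, h4⟩ := hD v
      rw [← hv'] at h0 h1 h2 h3 h4
      have hv0 : v'.1 0 = 0 := by rw [h0, hv]
      obtain ⟨hQ, hE⟩ := Q_derivBranch h hw hv0
      have hq : Q v' = Q v + k * v.2 2 ^ 2 := by
        rw [Q_eq hv, Q_eq hv0, h1, h2, h3, h4]
        ring
      have hs : 0 ≤ k * v.2 2 ^ 2 := by positivity
      refine ⟨by linarith, fun hle => ?_⟩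
      obtain ⟨hE1, hE2, hE3⟩ := hE (by linarith)
      have hz : v.2 2 = 0 := by
        have : k * v.2 2 ^ 2 = 0 := by linarith
        simpa [hk.ne'] using this
      rw [h3, hz, mul_zero, add_zero] at hE1
      refine ⟨by simpa using hE1, fun _ => hz, ?_⟩
      rintro l (⟨h10, -⟩ | hl)
      · exact absurd h10 (by decide)
      · have hl' := hE3 _ hl
        rw [← hl']
        fin_cases l <;> simp [zeta, h1, h2, hz, mirror, Equiv.swap_apply_def]
        ring

/-- Equality would kill `δξ` through the floor hits. It would also kill `δη`, since labels `1` and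
`2` can come down to the floor only if both types of ball-ball collisions occur. -/
theorem Q_lt_derivBranch {m : Fin 3 → ℝ} (h : WideMasses m) {c : ℝ} {w : List (Fin 3)} {x : Phase}
    (hw : IsBranch m c w x) (hits_w : ∀ l, l ∈ hits w) {v : Phase} (h1 : v.1 0 = 0)
    (h2 : v.2 0 = 0) (hv : v ≠ 0) : Q v < Q (derivBranch m w x v) := by
  by_contra! hle
  obtain ⟨e1, e2, e3⟩ := (Q_derivBranch h hw h1).2 hle
  have m1 : 1 ∈ w := by
    by_contra hn
    exact notMem_hits_of_ne_zero hn one_ne_zero (hits_w 1)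
  have m2 : 2 ∈ w := by
    by_contra hn
    exact two_notMem_hits hn (hits_w 2)
  have z0 : (1 - upRatio m) * v.1 1 = 0 := e3 0 (hits_w 0)
  have z2 : -v.1 2 = 0 := e3 2 (hits_w 2)
  have hne : 1 - upRatio m ≠ 0 := (sub_pos.2 h.upRatio_lt_one).ne'
  refine hv (Prod.ext (funext fun i => ?_) (funext fun i => ?_)) <;> fin_cases i
  · exact h1
  · simpa [hne] using z0
  · simpa using z2
  · exact h2
  · exact e1 m1
  · exact e2 m2

/-! ### From strict monotonicity to a least expansion above one -/

theorem continuous_Q : Continuous Q := by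
  unfold Q
  fun_prop

theorem Q_smul (r : ℝ) (v : Phase) : Q (r • v) = r ^ 2 * Q v := by
  simp only [Q, Finset.mul_sum]
  refine Finset.sum_congr rfl fun i _ => ?_
  simp
  ring

/-- The cone is not closed in the tangent space, since `Q` may tend to `0`. As the strict inequality
holds on the whole subspace, `Q (L v) - Q v` has a positive minimum `ε` on its unit sphere; with an
upper bound `B` of `Q` there, the ratio is at least `1 + ε / B` by homogeneity. -/
theorem one_lt_leastExpansion {L : Phase →L[ℝ] Phase}
    (hL : ∀ v : Phase, v.1 0 = 0 → v.2 0 = 0 → v ≠ 0 → Q v < Q (L v)) :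
    1 < leastExpansion L := by
  set S : Set Phase := {v | v.1 0 = 0 ∧ v.2 0 = 0} ∩ Metric.sphere 0 1 with hS
  have hSc : IsCompact S := by
    refine (isCompact_sphere 0 1).inter_left ?_
    exact (isClosed_eq (by fun_prop) continuous_const).inter
      (isClosed_eq (by fun_prop) continuous_const)
  have hQL : Continuous fun v => Q (L v) := continuous_Q.comp L.continuous
  let e : Phase := (![0, 1, 0], ![0, 1, 0])
  have he : e ≠ 0 := fun h0 => by
    have := congrArg (fun v : Phase => v.1 1) h0
    simp [e] at this
  have hSn : S.Nonempty := by
    refine ⟨‖e‖⁻¹ • e, ⟨by simp [e], by simp [e]⟩, ?_⟩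
    rw [mem_sphere_zero_iff_norm, norm_smul, norm_inv, norm_norm,
      inv_mul_cancel₀ (norm_ne_zero_iff.2 he)]
  obtain ⟨a, ha, hmin⟩ := hSc.exists_isMinOn hSn (hQL.sub continuous_Q).continuousOn
  obtain ⟨b, hb, hmax⟩ := hSc.exists_isMaxOn hSn continuous_Q.continuousOn
  have ha0 : a ≠ 0 := norm_ne_zero_iff.1 (by rw [mem_sphere_zero_iff_norm.1 ha.2]; exact one_ne_zero)
  set ε := Q (L a) - Q a with hε
  have hεpos : 0 < ε := sub_pos.2 (hL a ha.1.1 ha.1.2 ha0)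
  set B := max (Q b) 1
  have hB : 0 < B := lt_max_of_lt_right one_pos
  have key : ∀ v : Phase, v.1 0 = 0 → v.2 0 = 0 → 0 < Q v → 1 + ε / B ≤ Q (L v) / Q v := by
    intro v h1 h2 hQ
    have hv : v ≠ 0 := fun h0 => by simp [h0, Q] at hQ
    have hn : 0 < ‖v‖ := norm_pos_iff.2 hv
    set u := ‖v‖⁻¹ • v with hu
    have huS : u ∈ S := by
      refine ⟨⟨by simp [hu, h1], by simp [hu, h2]⟩, ?_⟩
      rw [mem_sphere_zero_iff_norm, norm_smul, norm_inv, norm_norm, inv_mul_cancel₀ hn.ne']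
    have hmu : ε ≤ Q (L u) - Q u := hmin huS
    have hMu : Q u ≤ B := le_trans (hmax huS) (le_max_left _ _)
    have hvu : v = ‖v‖ • u := by rw [hu, smul_smul, mul_inv_cancel₀ hn.ne', one_smul]
    have hqu : Q v = ‖v‖ ^ 2 * Q u := by rw [← Q_smul, ← hvu]
    have hqLu : Q (L v) = ‖v‖ ^ 2 * Q (L u) := by rw [← Q_smul, ← map_smul, ← hvu]
    have hupos : 0 < Q u := by
      rw [hqu] at hQ
      exact pos_of_mul_pos_right hQ (by positivity)
    rw [hqu, hqLu, mul_div_mul_left _ _ (by positivity), le_div_iff₀ hupos]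
    have : ε / B * Q u ≤ ε := by
      rw [div_mul_eq_mul_div, div_le_iff₀ hB]
      exact mul_le_mul_of_nonneg_left hMu hεpos.le
    linarith
  have hne : Nonempty (cone \ {0} : Set Phase) :=
    ⟨e, Or.inl ⟨by simp [e, Q, Fin.sum_univ_three], by simp [e], by simp [e]⟩, he⟩
  have h1 : 1 < √(1 + ε / B) := by
    rw [Real.lt_sqrt zero_le_one]
    have : 0 < ε / B := by positivity
    linarith
  refine h1.trans_le (le_ciInf ?_)
  rintro ⟨v, hv | hv, hv0⟩
  · exact Real.sqrt_le_sqrt (key v hv.2.1 hv.2.2 hv.1)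
  · exact absurd hv hv0

theorem mem_leastExpanding {m : Fin 3 → ℝ} (h : WideMasses m) {c : ℝ} {x : Phase}
    (hx : x ∈ phaseSpace m c) (hlong : ∀ n, ∃ w : List (Fin 3), w.length = n ∧ IsBranch m c w x)
    {n : ℕ} (hn : ∀ w : List (Fin 3), w.length = n → IsBranch m c w x → ∀ l, l ∈ hits w) :
    x ∈ leastExpanding m c := by
  refine ⟨hx, n, Nat.one_le_iff_ne_zero.2 ?_, hlong n, fun w hw hb =>
    one_lt_leastExpansion fun v h1 h2 hv => Q_lt_derivBranch h hb (hn w hw hb) h1 h2 hv⟩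
  rintro rfl
  exact hn [] rfl trivial 0

/-! ### Label coordinates

In these linear coordinates of the positions and of the velocities the three balls pass through each
other at a collision. -/

/-- The coordinates in which the ball-ball collisions are transpositions. -/
def labels (m : Fin 3 → ℝ) (u : Fin 3 → ℝ) : Fin 3 → ℝ :=
  ![u 0, lowRatio m * u 0 + (1 - lowRatio m) * u 1,
    lowRatio m * u 0 + (1 - lowRatio m) * (upRatio m * u 1 + (1 - upRatio m) * u 2)]

/-- The label coordinates of the positions. -/
def labelPos (m : Fin 3 → ℝ) (x : Phase) : Fin 3 → ℝ := labels m x.1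

/-- The label coordinates of the velocities. -/
def labelVel (m : Fin 3 → ℝ) (x : Phase) : Fin 3 → ℝ := labels m (vel m x)

section Labels

variable {m : Fin 3 → ℝ}

theorem labelVel_flow (hm : ∀ i, m i ≠ 0) (t : ℝ) (x : Phase) (i : Fin 3) :
    labelVel m (flow m t x) i = labelVel m x i - t := by
  fin_cases i <;> simp [labelVel, labels, vel_flow hm] <;> ring

theorem labelPos_flow (t : ℝ) (x : Phase) (i : Fin 3) :
    labelPos m (flow m t x) i = labelPos m x i + t * labelVel m x i - t ^ 2 / 2 := by
  fin_cases i <;> simp [labelPos, labelVel, labels, pos_flow] <;> ring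

theorem labelPos_collision (j : Fin 3) (x : Phase) :
    labelPos m (collision m j x) = labelPos m x := rfl

/-- Every label contains the velocity of the lowest ball: with weight `1` for label `0`, with weight
`γ` for the others. This is how a floor hit kicks the other two labels. -/
theorem labelVel_collision_zero (x : Phase) (i : Fin 3) :
    labelVel m (collision m 0 x) i =
      if i = 0 then -labelVel m x 0 else labelVel m x i - 2 * lowRatio m * labelVel m x 0 := by
  fin_cases i <;> simp [labelVel, labels, vel_collision_zero_zero, vel_collision_zero_one,
    vel_collision_zero_two] <;> ring

/-- The mass condition is needed only for the top label, which must not notice the collision of the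
lower two balls. -/
theorem WideMasses.labelVel_collision_one (h : WideMasses m) (x : Phase) (i : Fin 3) :
    labelVel m (collision m 1 x) (mirror 1 i) = labelVel m x i := by
  have hu := h.upRatio_mul
  fin_cases i <;> simp [labelVel, labels, vel_collision_one_zero h.pos_all,
    vel_collision_one_one h.pos_all, vel_collision_one_two, mirror, Equiv.swap_apply_def]
  · ring
  · linear_combination (1 - lowRatio m) * (vel m x 0 - vel m x 1) * hu

theorem WideMasses.labelVel_collision_two (h : WideMasses m) (x : Phase) (i : Fin 3) :
    labelVel m (collision m 2 x) (mirror 2 i) = labelVel m x i := by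
  fin_cases i <;> simp [labelVel, labels, vel_collision_two_zero,
    vel_collision_two_one h.pos_all, vel_collision_two_two h.pos_all, mirror,
    Equiv.swap_apply_def, -mul_eq_mul_left_iff, -add_right_inj]
  ring

theorem labels_one_sub (u : Fin 3 → ℝ) :
    labels m u 1 - labels m u 0 = (1 - lowRatio m) * (u 1 - u 0) := by
  simp [labels]
  ring

theorem labels_two_sub (u : Fin 3 → ℝ) :
    labels m u 2 - labels m u 1 = (1 - lowRatio m) * (1 - upRatio m) * (u 2 - u 1) := by
  simp [labels]
  ring

section Order

variable (h : WideMasses m) (u : Fin 3 → ℝ)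
include h

theorem WideMasses.labels_le_one : labels m u 0 ≤ labels m u 1 ↔ u 0 ≤ u 1 := by
  rw [← sub_nonneg, labels_one_sub, mul_nonneg_iff_of_pos_left (sub_pos.2 h.lowRatio_lt_one),
    sub_nonneg]

theorem WideMasses.labels_le_two : labels m u 1 ≤ labels m u 2 ↔ u 1 ≤ u 2 := by
  rw [← sub_nonneg, labels_two_sub, mul_nonneg_iff_of_pos_left (mul_pos
    (sub_pos.2 h.lowRatio_lt_one) (sub_pos.2 h.upRatio_lt_one)), sub_nonneg]

theorem WideMasses.labels_lt_one : labels m u 1 < labels m u 0 ↔ u 1 < u 0 :=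
  lt_iff_lt_of_le_iff_le (h.labels_le_one u)

theorem WideMasses.labels_lt_two : labels m u 2 < labels m u 1 ↔ u 2 < u 1 :=
  lt_iff_lt_of_le_iff_le (h.labels_le_two u)

theorem WideMasses.labels_eq_one : labels m u 1 = labels m u 0 ↔ u 1 = u 0 := by
  rw [← sub_eq_zero, labels_one_sub, mul_eq_zero, sub_eq_zero (a := u 1),
    or_iff_right (sub_pos.2 h.lowRatio_lt_one).ne']

theorem WideMasses.labels_eq_two : labels m u 2 = labels m u 1 ↔ u 2 = u 1 := by
  rw [← sub_eq_zero, labels_two_sub, mul_eq_zero, sub_eq_zero (a := u 2), or_iff_right (mul_pos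
    (sub_pos.2 h.lowRatio_lt_one) (sub_pos.2 h.upRatio_lt_one)).ne']

end Order

theorem WideMasses.mem_admissible_iff (h : WideMasses m) (x : Phase) :
    x ∈ admissible ↔
      0 ≤ labelPos m x 0 ∧ labelPos m x 0 ≤ labelPos m x 1 ∧ labelPos m x 1 ≤ labelPos m x 2 := by
  rw [labelPos, h.labels_le_one, h.labels_le_two]
  rfl

theorem mem_sectionMinus_zero {c : ℝ} {x : Phase} :
    x ∈ sectionMinus m c 0 ↔
      hamiltonian m x = c ∧ x ∈ admissible ∧ labelPos m x 0 = 0 ∧ labelVel m x 0 < 0 := Iff.rfl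

theorem WideMasses.mem_sectionMinus_one (h : WideMasses m) {c : ℝ} {x : Phase} :
    x ∈ sectionMinus m c 1 ↔ hamiltonian m x = c ∧ x ∈ admissible ∧
      labelPos m x 1 = labelPos m x 0 ∧ labelVel m x 1 < labelVel m x 0 := by
  rw [labelPos, labelVel, h.labels_eq_one, h.labels_lt_one]
  simp [sectionMinus, gap, gapVel, sub_eq_zero]

theorem WideMasses.mem_sectionMinus_two (h : WideMasses m) {c : ℝ} {x : Phase} :
    x ∈ sectionMinus m c 2 ↔ hamiltonian m x = c ∧ x ∈ admissible ∧
      labelPos m x 2 = labelPos m x 1 ∧ labelVel m x 2 < labelVel m x 1 := by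
  rw [labelPos, labelVel, h.labels_eq_two, h.labels_lt_two]
  simp [sectionMinus, gap, gapVel, sub_eq_zero]

/-- The label velocities are bounded on an energy surface. -/
theorem WideMasses.exists_abs_labelVel_le (h : WideMasses m) (c : ℝ) : ∃ C : ℝ, ∀ x ∈ admissible,
    hamiltonian m x = c → ∀ i, |labelVel m x i| ≤ C := by
  -- The potential energies are nonnegative and `m 2` is the smallest mass, so this bounds all
  -- velocities; the labels are convex combinations of them.
  refine ⟨√(2 * c / m 2), fun x hx hc => ?_⟩
  have hm := h.pos_all
  have hv : ∀ i, |vel m x i| ≤ √(2 * c / m 2) := by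
    have hq : ∀ i, 0 ≤ x.1 i := by
      obtain ⟨h0, h1, h2⟩ := hx
      intro i
      fin_cases i
      exacts [h0, h0.trans h1, (h0.trans h1).trans h2]
    have hb : ∀ i, m 2 * vel m x i ^ 2 / 2 ≤ ballEnergy m x i := fun i => by
      rw [ballEnergy_eq h.ne_zero]
      have h2 : m 2 ≤ m i := by
        fin_cases i
        exacts [(h.lt₁.trans h.lt₀).le, h.lt₁.le, le_rfl]
      nlinarith [mul_nonneg (sub_nonneg.2 h2) (sq_nonneg (vel m x i)), mul_nonneg (hm i).le (hq i)]
    have hb0 : ∀ i, 0 ≤ ballEnergy m x i := fun i => by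
      have := hb i
      have := mul_nonneg h.pos.le (sq_nonneg (vel m x i))
      linarith
    intro i
    refine Real.abs_le_sqrt ?_
    rw [le_div_iff₀ h.pos, ← hc, hamiltonian_eq]
    have := hb i
    have := hb0 0
    have := hb0 1
    have := hb0 2
    fin_cases i <;> simp at * <;> linarith
  have g0 := h.lowRatio_pos
  have g1 := sub_pos.2 h.lowRatio_lt_one
  have u0 := h.upRatio_pos
  have u1 := sub_pos.2 h.upRatio_lt_one
  have key : ∀ {a b C t : ℝ}, 0 < t → 0 < 1 - t → |a| ≤ C → |b| ≤ C →
      |t * a + (1 - t) * b| ≤ C := fun ht ht' ha hb => by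
    rw [abs_le] at *
    constructor <;> nlinarith
  intro i
  fin_cases i
  · exact hv 0
  · exact key g0 g1 (hv 0) (hv 1)
  · exact key g0 g1 (hv 0) (key u0 u1 (hv 1) (hv 2))

end Labels

theorem Step.energy {m : Fin 3 → ℝ} (hm : ∀ i, 0 < m i) {c : ℝ} {j : Fin 3} {x y : Phase}
    (hs : Step m c j x y) : hamiltonian m y = c ∧ y ∈ admissible := by
  obtain ⟨τ, -, -, -, ⟨hc, ha, -⟩, rfl⟩ := hs
  exact ⟨by rw [hamiltonian_collision hm, hc], ha⟩

/-- The time `τ` up to the next collision, and the speed `a` of the label which hits the floor;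
`a = 0` for a ball-ball collision. -/
theorem Step.exists_labels {m : Fin 3 → ℝ} (h : WideMasses m) {c : ℝ} {j : Fin 3} {x y : Phase}
    (hs : Step m c j x y) : ∃ τ a : ℝ,
      (∀ i, labelPos m y (mirror j i) = labelPos m x i + τ * labelVel m x i - τ ^ 2 / 2) ∧
      (∀ i, labelVel m y (mirror j i) =
        labelVel m x i - τ + if i = 0 then 2 * a else 2 * lowRatio m * a) ∧
      (j = 0 → 0 < a ∧ labelVel m x 0 - τ = -a ∧ labelPos m y 0 = 0) ∧
      (j ≠ 0 → a = 0) ∧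
      (j = 1 → labelVel m x 1 < labelVel m x 0) ∧ (j = 2 → labelVel m x 2 < labelVel m x 1) := by
  obtain ⟨τ, -, -, -, hτ, rfl⟩ := hs
  have hj : j = 0 ∨ j = 1 ∨ j = 2 := by
    fin_cases j <;> simp
  rcases hj with rfl | rfl | rfl
  · obtain ⟨-, -, h0, h1⟩ := mem_sectionMinus_zero.1 hτ
    rw [labelVel_flow h.ne_zero] at h1
    refine ⟨τ, τ - labelVel m x 0, fun i => ?_, fun i => ?_, fun _ => ⟨by linarith, by ring, ?_⟩,
      fun h => absurd rfl h, fun h => absurd h (by decide), fun h => absurd h (by decide)⟩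
    · rw [labelPos_collision, ← labelPos_flow]
      rfl
    · change labelVel m _ i = _
      rw [labelVel_collision_zero, labelVel_flow h.ne_zero, labelVel_flow h.ne_zero]
      split_ifs with hi
      · rw [hi]
        ring
      · ring
    · rwa [labelPos_collision]
  · obtain ⟨-, -, h0, h1⟩ := h.mem_sectionMinus_one.1 hτ
    rw [labelVel_flow h.ne_zero, labelVel_flow h.ne_zero] at h1
    refine ⟨τ, 0, fun i => ?_, fun i => ?_, fun h => absurd h (by decide), fun _ => rfl,
      fun _ => by linarith, fun h => absurd h (by decide)⟩
    · rw [labelPos_collision, ← labelPos_flow]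
      fin_cases i <;> simp [mirror, Equiv.swap_apply_def, h0]
    · rw [h.labelVel_collision_one, labelVel_flow h.ne_zero]
      simp
  · obtain ⟨-, -, h0, h1⟩ := h.mem_sectionMinus_two.1 hτ
    rw [labelVel_flow h.ne_zero, labelVel_flow h.ne_zero] at h1
    refine ⟨τ, 0, fun i => ?_, fun i => ?_, fun h => absurd h (by decide), fun _ => rfl,
      fun h => absurd h (by decide), fun _ => by linarith⟩
    · rw [labelPos_collision, ← labelPos_flow]
      fin_cases i <;> simp [mirror, Equiv.swap_apply_def, h0]
    · rw [h.labelVel_collision_two, labelVel_flow h.ne_zero]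
      simp

/-! ### Every infinite branch hits the floor with all labels -/

section Wedge

open Filter Topology

/-- Two labels with the velocities `p`, `q` and the positions `P`, `Q` hit the floor with the speeds
`a n`, `b n`, and a third one with the velocity `r` does not hit the floor. There are no such
motions with infinitely many hits and bounded velocities. -/
theorem false_of_frequently_hits {γ C : ℝ} (hγ0 : 0 < γ) (hγ1 : γ < 1)
    {p q r P Q τ a b : ℕ → ℝ}
    (hp : ∀ n, p (n + 1) = p n - τ n + 2 * a n + 2 * γ * b n)
    (hq : ∀ n, q (n + 1) = q n - τ n + 2 * γ * a n + 2 * b n)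
    (hr : ∀ n, r (n + 1) = r n - τ n + 2 * γ * a n + 2 * γ * b n)
    (hP : ∀ n, P (n + 1) = P n + τ n * p n - τ n ^ 2 / 2)
    (hQ : ∀ n, Q (n + 1) = Q n + τ n * q n - τ n ^ 2 / 2)
    (bp : ∀ n, |p n| ≤ C) (bq : ∀ n, |q n| ≤ C) (br : ∀ n, |r n| ≤ C)
    (P0 : ∀ n, 0 ≤ P n) (Q0 : ∀ n, 0 ≤ Q n) (a0 : ∀ n, 0 ≤ a n) (b0 : ∀ n, 0 ≤ b n)
    (ha : ∀ n, 0 < a n → p n - τ n = -a n ∧ P (n + 1) = 0 ∧ b n = 0)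
    (hb : ∀ n, 0 < b n → q n - τ n = -b n ∧ Q (n + 1) = 0 ∧ a n = 0)
    (hf : ∃ᶠ n in atTop, 0 < a n) : False := by
  have hγ : 0 < 1 + γ := by linarith
  have hC : 0 ≤ C := (abs_nonneg _).trans (bp 0)
  -- the total time is bounded
  have hU : ∀ n, (1 + γ) * r n - γ * (p n + q n) + (1 - γ) * ∑ k ∈ Finset.range n, τ k =
      (1 + γ) * r 0 - γ * (p 0 + q 0) := fun n => by
    induction n with
    | zero => simp
    | succ n ih =>
      rw [Finset.sum_range_succ, hr, hp, hq, ← ih]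
      ring
  have hbd : ∀ n, |(1 + γ) * r n - γ * (p n + q n)| ≤ 4 * C := fun n => by
    have h1 := abs_le.1 (bp n)
    have h2 := abs_le.1 (bq n)
    have h3 := abs_le.1 (br n)
    rw [abs_le]
    constructor <;> nlinarith
  have htime : ∀ n, ∑ k ∈ Finset.range n, τ k ≤ 8 * C / (1 - γ) := fun n => by
    rw [le_div_iff₀ (by linarith)]
    have h1 := abs_le.1 (hbd n)
    have h2 := abs_le.1 (hbd 0)
    have h3 := hU n
    linarith
  -- The label that never hits is pushed up only by the hits of the others. Its velocity and the
  -- total time are bounded, so the hit speeds are summable.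
  have hS : ∀ n, 2 * γ * ∑ k ∈ Finset.range n, (a k + b k) =
      r n - r 0 + ∑ k ∈ Finset.range n, τ k := fun n => by
    induction n with
    | zero => simp
    | succ n ih =>
      rw [Finset.sum_range_succ, Finset.sum_range_succ, hr, mul_add, ih]
      ring
  have hsum : ∀ n, ∑ k ∈ Finset.range n, (a k + b k) ≤ (2 * C + 8 * C / (1 - γ)) / (2 * γ) :=
    fun n => by
    rw [le_div_iff₀ (by linarith)]
    have h1 := abs_le.1 (br n)
    have h2 := abs_le.1 (br 0)
    have h3 := hS n
    have h4 := htime n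
    linarith
  have hab : Summable fun n => a n + b n :=
    summable_of_sum_range_le (fun n => add_nonneg (a0 n) (b0 n)) hsum
  have hsa : Summable a := hab.of_nonneg_of_le a0 fun n => by linarith [b0 n]
  have hsb : Summable b := hab.of_nonneg_of_le b0 fun n => by linarith [a0 n]
  -- the energies of the single labels
  have ea : ∀ n, p (n + 1) ^ 2 / 2 + P (n + 1) =
      p n ^ 2 / 2 + P n + 2 * γ * b n * (p (n + 1) - γ * b n) := fun n => by
    rcases (a0 n).eq_or_lt with h0 | h0
    · rw [hP, hp, ← h0]
      ring
    · obtain ⟨h1, -, h3⟩ := ha n h0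
      have h4 := hp n
      rw [hP, h4, h3]
      linear_combination 2 * a n * h1
  have eb : ∀ n, q (n + 1) ^ 2 / 2 + Q (n + 1) =
      q n ^ 2 / 2 + Q n + 2 * γ * a n * (q (n + 1) - γ * a n) := fun n => by
    rcases (b0 n).eq_or_lt with h0 | h0
    · rw [hQ, hq, ← h0]
      ring
    · obtain ⟨h1, -, h3⟩ := hb n h0
      have h4 := hq n
      rw [hQ, h4, h3]
      linear_combination 2 * b n * h1
  have pa : ∀ n, 0 < a n → p (n + 1) = a n := fun n h0 => by
    obtain ⟨h1, -, h3⟩ := ha n h0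
    rw [hp, h3]
    linarith
  have qb : ∀ n, 0 < b n → q (n + 1) = b n := fun n h0 => by
    obtain ⟨h1, -, h3⟩ := hb n h0
    rw [hq, h3]
    linarith
  have aC : ∀ n, a n ≤ C := fun n => by
    rcases (a0 n).eq_or_lt with h0 | h0
    · rwa [← h0]
    · rw [← pa n h0]
      exact (le_abs_self _).trans (bp _)
  have bC : ∀ n, b n ≤ C := fun n => by
    rcases (b0 n).eq_or_lt with h0 | h0
    · rwa [← h0]
    · rw [← qb n h0]
      exact (le_abs_self _).trans (bq _)
  -- A label's own hits preserve its energy. A hit of the other label with speed `s` changes it by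
  -- at most `4 C s`, which is summable.
  have hlim : ∀ {e s v : ℕ → ℝ}, (∀ n, e (n + 1) = e n + 2 * γ * s n * (v (n + 1) - γ * s n)) →
      (∀ n, 0 ≤ s n) → (∀ n, s n ≤ C) → (∀ n, |v n| ≤ C) → Summable s →
      ∃ L, Tendsto e atTop (𝓝 L) := by
    intro e s v he s0 sC vC hs
    refine cauchySeq_tendsto_of_complete
      (cauchySeq_of_dist_le_of_summable (fun n => 4 * C * s n) (fun n => ?_) (hs.mul_left _))
    rw [dist_comm, Real.dist_eq, he, add_sub_cancel_left, abs_mul, abs_of_nonneg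
      (by have := s0 n; positivity)]
    have h1 : |v (n + 1) - γ * s n| ≤ 2 * C := by
      have h1 := abs_le.1 (vC (n + 1))
      have h2 := s0 n
      have h3 := sC n
      rw [abs_le]
      constructor <;> nlinarith
    have h2 : 2 * γ * s n ≤ 2 * s n := by nlinarith [s0 n]
    calc 2 * γ * s n * |v (n + 1) - γ * s n| ≤ 2 * s n * (2 * C) :=
          mul_le_mul h2 h1 (abs_nonneg _) (by have := s0 n; positivity)
      _ = 4 * C * s n := by ring
  -- Right after its own hit a label has the energy `s² / 2`, which tends to zero along the hits.
  have hzero : ∀ {e s : ℕ → ℝ} {L : ℝ}, Tendsto e atTop (𝓝 L) → Summable s →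
      (∀ n, 0 < s n → e (n + 1) = s n ^ 2 / 2) → (∃ᶠ n in atTop, 0 < s n) → L = 0 := by
    intro e s L he hs hes hfs
    have h1 : Tendsto (fun n => e (n + 1) - s n ^ 2 / 2) atTop (𝓝 (L - 0 ^ 2 / 2)) :=
      ((tendsto_add_atTop_iff_nat 1).2 he).sub ((hs.tendsto_atTop_zero.pow 2).div_const 2)
    have h2 : L - 0 ^ 2 / 2 = 0 := by
      by_contra hne
      obtain ⟨n, hn, hn'⟩ := (hfs.and_eventually (h1.eventually_ne hne)).exists
      exact hn' (by rw [hes n hn, sub_self])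
    simpa using h2
  have ehit : ∀ n, 0 < a n → p (n + 1) ^ 2 / 2 + P (n + 1) = a n ^ 2 / 2 := fun n h0 => by
    rw [pa n h0, (ha n h0).2.1, add_zero]
  obtain ⟨Lp, hLp⟩ := hlim (e := fun n => p n ^ 2 / 2 + P n) ea b0 bC bp hsb
  obtain ⟨Lq, hLq⟩ := hlim (e := fun n => q n ^ 2 / 2 + Q n) eb a0 aC bq hsa
  obtain rfl := hzero hLp hsa ehit hf
  by_cases hfb : ∃ᶠ n in atTop, 0 < b n
  · obtain rfl := hzero hLq hsb
      (fun n h0 => by simp only [qb n h0, (hb n h0).2.1, add_zero]) hfb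
    -- A joint energy of the two hitting labels is conserved. It is dominated by their single
    -- energies, which tend to zero, but it is positive right after a hit because `γ < 1`.
    have hE : ∀ n, p n ^ 2 + q n ^ 2 - 2 * γ * p n * q n + 2 * (1 - γ) * (P n + Q n) =
        p 0 ^ 2 + q 0 ^ 2 - 2 * γ * p 0 * q 0 + 2 * (1 - γ) * (P 0 + Q 0) := fun n => by
      induction n with
      | zero => rfl
      | succ n ih =>
        rw [← ih]
        rcases (a0 n).eq_or_lt with h0 | h0
        · rcases (b0 n).eq_or_lt with h1 | h1
          · rw [hP, hQ, hp, hq, ← h0, ← h1]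
            ring
          · obtain ⟨e1, -, e3⟩ := hb n h1
            rw [hP, hQ, hp, hq, e3, show q n = τ n - b n by linarith]
            ring
        · obtain ⟨e1, -, e3⟩ := ha n h0
          rw [hP, hQ, hp, hq, e3, show p n = τ n - a n by linarith]
          ring
    have hle : ∀ n, p n ^ 2 + q n ^ 2 - 2 * γ * p n * q n + 2 * (1 - γ) * (P n + Q n) ≤
        4 * ((p n ^ 2 / 2 + P n) + (q n ^ 2 / 2 + Q n)) := fun n => by
      nlinarith [P0 n, Q0 n, mul_nonneg hγ0.le (sq_nonneg (p n + q n)),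
        mul_nonneg (sub_nonneg.2 hγ1.le) (sq_nonneg (p n)),
        mul_nonneg (sub_nonneg.2 hγ1.le) (sq_nonneg (q n)), mul_nonneg hγ0.le (P0 n),
        mul_nonneg hγ0.le (Q0 n)]
    have hlim0 : Tendsto (fun n => 4 * ((p n ^ 2 / 2 + P n) + (q n ^ 2 / 2 + Q n))) atTop (𝓝 0) := by
      simpa using (hLp.add hLq).const_mul 4
    have hE0 : p 0 ^ 2 + q 0 ^ 2 - 2 * γ * p 0 * q 0 + 2 * (1 - γ) * (P 0 + Q 0) ≤ 0 :=
      ge_of_tendsto hlim0 (.of_forall fun n => (hE n).symm.trans_le (hle n))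
    obtain ⟨n, hn⟩ := hf.exists
    have h1 := (hE (n + 1)).trans_le hE0
    rw [pa n hn, (ha n hn).2.1] at h1
    nlinarith [mul_nonneg (sub_nonneg.2 hγ1.le) (Q0 (n + 1)), mul_nonneg hγ0.le
      (sq_nonneg (a n - q (n + 1))), mul_pos (sub_pos.2 hγ1) (pow_pos hn 2),
      mul_nonneg (sub_nonneg.2 hγ1.le) (sq_nonneg (q (n + 1)))]
  -- If the second label stops hitting, the energy of the first is eventually constant, hence equal
  -- to its limit `0`, and this forbids further hits.
  · rw [not_frequently] at hfb
    obtain ⟨N, hN⟩ := eventually_atTop.1 hfb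
    have hconst : ∀ n ≥ N, p n ^ 2 / 2 + P n = p N ^ 2 / 2 + P N := fun n hn => by
      induction n, hn using Nat.le_induction with
      | base => rfl
      | succ n hn ih =>
        have h0 : b n = 0 := le_antisymm (not_lt.1 (hN n hn)) (b0 n)
        rw [ea, ih, h0]
        ring
    have hN0 : p N ^ 2 / 2 + P N = 0 :=
      tendsto_nhds_unique (tendsto_const_nhds.congr'
        ((eventually_ge_atTop N).mono fun n hn => (hconst n hn).symm)) hLp
    obtain ⟨n, hn, hn'⟩ := (hf.and_eventually (eventually_ge_atTop N)).exists
    have h1 := hconst (n + 1) (by omega)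
    rw [ehit n hn, hN0] at h1
    have := pow_pos hn 2
    linarith

end Wedge

/-- The number of pairs of labels whose velocities are in the wrong order. -/
def inversions (F : Fin 3 → ℝ) : ℕ :=
  (if F 1 < F 0 then 1 else 0) + (if F 2 < F 0 then 1 else 0) + (if F 2 < F 1 then 1 else 0)

/-- Free flight shifts all label velocities equally, and a ball-ball collision exchanges two
adjacent ones that are in the wrong order. Hence ball-ball collisions cannot go on without floor
hits. -/
theorem Step.inversions_lt {m : Fin 3 → ℝ} (h : WideMasses m) {c : ℝ} {j : Fin 3} {x y : Phase}
    (hs : Step m c j x y) (hj : j ≠ 0) :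
    inversions (labelVel m y) < inversions (labelVel m x) := by
  obtain ⟨τ, a, -, hF, -, ha, h1, h2⟩ := hs.exists_labels h
  simp only [ha hj, mul_zero, ite_self, add_zero] at hF
  have hj : j = 1 ∨ j = 2 := by
    revert hj
    fin_cases j <;> simp
  rcases hj with rfl | rfl
  · have f0 : labelVel m y 0 = labelVel m x 1 - τ := by simpa [mirror] using hF 1
    have f1 : labelVel m y 1 = labelVel m x 0 - τ := by simpa [mirror] using hF 0
    have f2 : labelVel m y 2 = labelVel m x 2 - τ := by
      simpa [mirror, Equiv.swap_apply_def] using hF 2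
    have hlt := h1 rfl
    simp only [inversions, f0, f1, f2, sub_lt_sub_iff_right, if_pos hlt, if_neg hlt.not_gt]
    omega
  · have f0 : labelVel m y 0 = labelVel m x 0 - τ := by
      simpa [mirror, Equiv.swap_apply_def] using hF 0
    have f1 : labelVel m y 1 = labelVel m x 2 - τ := by simpa [mirror] using hF 2
    have f2 : labelVel m y 2 = labelVel m x 1 - τ := by simpa [mirror] using hF 1
    have hlt := h2 rfl
    simp only [inversions, f0, f1, f2, sub_lt_sub_iff_right, if_pos hlt, if_neg hlt.not_gt]
    omega

section Orbit

open Filter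

variable {m : Fin 3 → ℝ} (h : WideMasses m) {c : ℝ}
include h

theorem frequently_floor {x : ℕ → Phase} {J : ℕ → Fin 3}
    (hs : ∀ n, Step m c (J n) (x n) (x (n + 1))) : ∃ᶠ n in atTop, J n = 0 := by
  intro hev
  obtain ⟨N, hN⟩ := eventually_atTop.1 hev
  have key : ∀ k, inversions (labelVel m (x (N + k))) + k ≤ inversions (labelVel m (x N)) :=
    fun k => by
      induction k with
      | zero => simp
      | succ k ih =>
        have := (hs (N + k)).inversions_lt h (hN _ (Nat.le_add_right _ _))
        rw [add_assoc] at this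
        omega
  have := key (inversions (labelVel m (x N)) + 1)
  omega

theorem admissible_labelPos_nonneg {x : Phase} (hx : x ∈ admissible) (i : Fin 3) :
    0 ≤ labelPos m x i := by
  obtain ⟨h0, h1, h2⟩ := (h.mem_admissible_iff x).1 hx
  fin_cases i
  exacts [h0, h0.trans h1, (h0.trans h1).trans h2]

/-- On an infinite branch every label hits the floor. -/
theorem exists_floor_hit {x : ℕ → Phase} {J l : ℕ → Fin 3} (hx0 : hamiltonian m (x 0) = c)
    (hx1 : x 0 ∈ admissible) (hs : ∀ n, Step m c (J n) (x n) (x (n + 1)))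
    (hl : ∀ n, l (n + 1) = mirror (J n) (l n)) : ∃ n, J n = 0 ∧ l n = 0 := by
  by_contra! hmiss
  have henergy : ∀ n, hamiltonian m (x n) = c ∧ x n ∈ admissible := fun n => by
    cases n with
    | zero => exact ⟨hx0, hx1⟩
    | succ n => exact (hs n).energy h.pos_all
  obtain ⟨C, hC⟩ := h.exists_abs_labelVel_le c
  choose τ a hG hF hfloor hball hlow hup using fun n => (hs n).exists_labels h
  -- the positions of all labels in the course of time
  obtain ⟨π, hπ0, hπ⟩ : ∃ π : ℕ → Equiv.Perm (Fin 3), π 0 = 1 ∧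
      ∀ n, π (n + 1) = mirror (J n) * π n :=
    ⟨fun n => Nat.rec 1 (fun n σ => mirror (J n) * σ) n, rfl, fun _ => rfl⟩
  have hlπ : ∀ n, l n = π n (l 0) := fun n => by
    induction n with
    | zero => simp [hπ0]
    | succ n ih => rw [hl, hπ, Equiv.Perm.mul_apply, ih]
  obtain ⟨i, k, hik, hil, hkl, hall⟩ : ∃ i k : Fin 3, i ≠ k ∧ i ≠ l 0 ∧ k ≠ l 0 ∧
      ∀ s, s = i ∨ s = k ∨ s = l 0 := by
    generalize l 0 = s
    revert s
    decide
  -- The speed with which the label that started at position `s` hits the floor in step `n`, and `0`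
  -- if it does not.
  let hit : ℕ → Fin 3 → ℝ := fun n s => if π n s = 0 then a n else 0
  have ha0 : ∀ n, 0 ≤ a n := fun n => by
    by_cases hj : J n = 0
    · exact (hfloor n hj).1.le
    · rw [hball n hj]
  have hhit0 : ∀ n s, 0 ≤ hit n s := fun n s => by
    simp only [hit]
    split_ifs
    exacts [ha0 n, le_rfl]
  have hmiss' : ∀ n, hit n (l 0) = 0 := fun n => by
    simp only [hit, ← hlπ]
    split_ifs with h0
    · exact hball n fun hj => hmiss n hj h0
    · rfl
  have hone : ∀ n s t, s ≠ t → 0 < hit n s → hit n t = 0 := fun n s t hst hs => by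
    simp only [hit] at hs ⊢
    split_ifs at hs with h1
    · rw [if_neg fun h2 => hst ((π n).injective (h1.trans h2.symm))]
    · exact absurd hs (lt_irrefl 0)
  have hpos : ∀ n s, 0 < hit n s → labelVel m (x n) (π n s) - τ n = -hit n s ∧
      labelPos m (x (n + 1)) (π (n + 1) s) = 0 := fun n s hs => by
    simp only [hit] at hs ⊢
    split_ifs at hs ⊢ with h1
    · have hj : J n = 0 := by
        by_contra hj
        rw [hball n hj] at hs
        exact lt_irrefl 0 hs
      obtain ⟨-, h3, h4⟩ := hfloor n hj
      rw [hπ, Equiv.Perm.mul_apply, h1, hj]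
      exact ⟨h3, h4⟩
    · exact absurd hs (lt_irrefl 0)
  have hvel : ∀ n s, labelVel m (x (n + 1)) (π (n + 1) s) =
      labelVel m (x n) (π n s) - τ n + 2 * hit n s +
        2 * lowRatio m * ∑ t ∈ Finset.univ.erase s, hit n t := fun n s => by
    rw [hπ, Equiv.Perm.mul_apply, hF]
    have htot : ∑ t, hit n t = a n := by
      rw [Finset.sum_eq_single ((π n).symm 0)]
      · simp [hit]
      · intro t _ ht
        simp only [hit]
        rw [if_neg fun h0 => ht (by rw [← h0, Equiv.symm_apply_apply])]
      · simp
    have hsplit := Finset.add_sum_erase Finset.univ (hit n) (Finset.mem_univ s)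
    rw [htot] at hsplit
    by_cases h0 : π n s = 0
    · have e : hit n s = a n := if_pos h0
      have e' : ∑ t ∈ Finset.univ.erase s, hit n t = 0 := by linarith
      rw [if_pos h0, e, e']
      ring
    · have e : hit n s = 0 := if_neg h0
      have e' : ∑ t ∈ Finset.univ.erase s, hit n t = a n := by linarith
      rw [if_neg h0, e, e']
      ring
  have hsum : ∀ n s t u, s ≠ t → s ≠ u → t ≠ u →
      ∑ v ∈ Finset.univ.erase s, hit n v = hit n t + hit n u := fun n s t u hst hsu htu => by
    have : (Finset.univ.erase s : Finset (Fin 3)) = {t, u} := by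
      revert s t u
      decide
    rw [this, Finset.sum_pair htu]
  have hposn : ∀ n s, labelPos m (x (n + 1)) (π (n + 1) s) =
      labelPos m (x n) (π n s) + τ n * labelVel m (x n) (π n s) - τ n ^ 2 / 2 := fun n s => by
    rw [hπ, Equiv.Perm.mul_apply, hG]
  have hfreq : ∃ᶠ n in atTop, 0 < hit n i ∨ 0 < hit n k := by
    refine (frequently_floor h hs).mono fun n hj => ?_
    have hap := (hfloor n hj).1
    have : 0 < hit n ((π n).symm 0) := by simpa [hit] using hap
    rcases hall ((π n).symm 0) with h1 | h1 | h1
    · exact Or.inl (h1 ▸ this)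
    · exact Or.inr (h1 ▸ this)
    · rw [h1, hmiss'] at this
      exact absurd this (lt_irrefl 0)
  -- Floor hits occur infinitely often and `l 0` has none, so one of the two other labels hits
  -- infinitely often. Their roles are symmetric.
  have key : ∀ s t, s ≠ t → s ≠ l 0 → t ≠ l 0 → (∃ᶠ n in atTop, 0 < hit n s) → False := by
    intro s t hst hsl htl hfr
    refine false_of_frequently_hits h.lowRatio_pos h.lowRatio_lt_one (C := C)
      (p := fun n => labelVel m (x n) (π n s)) (q := fun n => labelVel m (x n) (π n t))
      (r := fun n => labelVel m (x n) (π n (l 0)))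
      (P := fun n => labelPos m (x n) (π n s)) (Q := fun n => labelPos m (x n) (π n t))
      (τ := τ) (a := fun n => hit n s) (b := fun n => hit n t)
      (fun n => ?_) (fun n => ?_) (fun n => ?_) (fun n => hposn n s) (fun n => hposn n t)
      (fun n => hC _ (henergy n).2 (henergy n).1 _) (fun n => hC _ (henergy n).2 (henergy n).1 _)
      (fun n => hC _ (henergy n).2 (henergy n).1 _)
      (fun n => admissible_labelPos_nonneg h (henergy n).2 _)
      (fun n => admissible_labelPos_nonneg h (henergy n).2 _)
      (fun n => hhit0 n s) (fun n => hhit0 n t)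
      (fun n hn => ⟨(hpos n s hn).1, (hpos n s hn).2, hone n s t hst hn⟩)
      (fun n hn => ⟨(hpos n t hn).1, (hpos n t hn).2, hone n t s hst.symm hn⟩) hfr
    · simp only [hvel n s, hsum n s t (l 0) hst hsl htl, hmiss']
      ring
    · simp only [hvel n t, hsum n t s (l 0) hst.symm htl hsl, hmiss']
      ring
    · simp only [hvel n (l 0), hsum n (l 0) s t hsl.symm htl.symm hst, hmiss']
      ring
  rcases frequently_or_distrib.1 hfreq with hf | hf
  · exact key i k hik hil hkl hf
  · exact key k i hik.symm hkl hil hf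

/-! ### König's lemma: from infinite branches to long finite ones -/

omit h in
theorem IsBranch.take {m : Fin 3 → ℝ} {c : ℝ} :
    ∀ {w : List (Fin 3)} {x : Phase} (n : ℕ), IsBranch m c w x → IsBranch m c (w.take n) x
  | [], _, n, _ => by simp [IsBranch]
  | _ :: _, _, 0, _ => trivial
  | _ :: _, _, n + 1, ⟨y, hy, hw⟩ => ⟨y, hy, IsBranch.take n hw⟩

omit h in
-- Lengthening a branch loses no floor hits, so bounds for several labels or successors can be
-- replaced by their maximum.
theorem hits_take_subset : ∀ (w : List (Fin 3)) (n : ℕ), hits (w.take n) ⊆ hits w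
  | [], n => by simp
  | _ :: _, 0 => fun _ h => h.elim
  | _ :: w, n + 1 => fun _ h => h.imp_right fun h => hits_take_subset w n h

/-- There are arbitrarily long branches at `x` on which the label `l` does not hit the floor. -/
def Misses (m : Fin 3 → ℝ) (c : ℝ) (x : Phase) (l : Fin 3) : Prop :=
  ∀ n, ∃ w : List (Fin 3), w.length = n ∧ IsBranch m c w x ∧ l ∉ hits w

/-- The step of König's lemma. A state has at most three successors, one for each collision type. If
none kept the property, each would have a bound on the length of missing branches, and a branch
longer than all these bounds would contradict the hypothesis. -/
theorem Misses.exists_step {x : Phase} {l : Fin 3} (hx : Misses m c x l) :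
    ∃ j y, Step m c j x y ∧ ¬(j = 0 ∧ l = 0) ∧ Misses m c y (mirror j l) := by
  by_contra! hcon
  have hfin : ∀ j, ∃ n, Step m c j x (branchMap m j x) → ¬(j = 0 ∧ l = 0) →
      ∀ w : List (Fin 3), w.length = n → IsBranch m c w (branchMap m j x) → mirror j l ∈ hits w := by
    intro j
    by_cases hj : Step m c j x (branchMap m j x) ∧ ¬(j = 0 ∧ l = 0)
    · have := hcon j _ hj.1 (fun h0 => fun hl => hj.2 ⟨h0, hl⟩)
      simp only [Misses, not_forall, not_exists, not_and, not_not] at this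
      obtain ⟨n, hn⟩ := this
      exact ⟨n, fun _ _ => hn⟩
    · exact ⟨0, fun h1 h2 => absurd ⟨h1, h2⟩ hj⟩
  choose N hN using hfin
  obtain ⟨w, hw, hb, hl⟩ := hx (Finset.univ.sup N + 1)
  match w, hw, hb, hl with
  | j :: u, hw, ⟨y, hy, hu⟩, hl =>
    have hxy := hy.eq_branchMap h.ne_zero
    subst hxy
    have hle : N j ≤ u.length := by
      have := Finset.le_sup (f := N) (Finset.mem_univ j)
      simp only [List.length_cons] at hw
      omega
    refine hl (Or.inr (hits_take_subset u (N j) ?_))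
    exact hN j hy (fun h0 => hl (Or.inl h0)) _ (by simp [hle]) (hu.take (N j))

theorem not_misses {x : Phase} (hx0 : hamiltonian m x = c) (hx1 : x ∈ admissible) (l : Fin 3) :
    ¬Misses m c x l := by
  intro hx
  have hex : ∀ s : Phase × Fin 3, ∃ t : Phase × Fin 3 × Fin 3, Misses m c s.1 s.2 →
      Step m c t.2.1 s.1 t.1 ∧ ¬(t.2.1 = 0 ∧ s.2 = 0) ∧ t.2.2 = mirror t.2.1 s.2 ∧
        Misses m c t.1 t.2.2 := fun s => by
    by_cases hs : Misses m c s.1 s.2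
    · obtain ⟨j, y, h1, h2, h3⟩ := hs.exists_step h
      exact ⟨(y, j, mirror j s.2), fun _ => ⟨h1, h2, rfl, h3⟩⟩
    -- A junk value; the iteration below never leaves the states with the property `Misses`.
    · exact ⟨(s.1, 0, 0), fun h1 => absurd h1 hs⟩
  choose f hf using hex
  let s : ℕ → Phase × Fin 3 := fun n => (fun s => ((f s).1, (f s).2.2))^[n] (x, l)
  have hsucc : ∀ n, s (n + 1) = ((f (s n)).1, (f (s n)).2.2) := fun n =>
    Function.iterate_succ_apply' _ _ _
  have hs : ∀ n, Misses m c (s n).1 (s n).2 := fun n => by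
    induction n with
    | zero => exact hx
    | succ n ih =>
      rw [hsucc]
      exact (hf _ ih).2.2.2
  obtain ⟨n, h1, h2⟩ := exists_floor_hit h (x := fun n => (s n).1) (J := fun n => (f (s n)).2.1)
    (l := fun n => (s n).2) hx0 hx1
    (fun n => by simpa only [hsucc] using (hf _ (hs n)).1)
    (fun n => by simpa only [hsucc] using (hf _ (hs n)).2.2.1)
  exact (hf _ (hs n)).2.1 ⟨h1, h2⟩

/-- All long branches hit the floor with all labels. -/
theorem exists_forall_mem_hits {x : Phase} (hx0 : hamiltonian m x = c) (hx1 : x ∈ admissible) :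
    ∃ n, ∀ w : List (Fin 3), w.length = n → IsBranch m c w x → ∀ l, l ∈ hits w := by
  have hfin : ∀ l, ∃ n, ∀ w : List (Fin 3), w.length = n → IsBranch m c w x → l ∈ hits w :=
    fun l => by
      have := not_misses h hx0 hx1 l
      simpa only [Misses, not_forall, not_exists, not_and, not_not] using this
  choose N hN using hfin
  refine ⟨Finset.univ.sup N, fun w hw hb l => hits_take_subset w (N l) ?_⟩
  refine hN l _ ?_ (hb.take _)
  have := Finset.le_sup (f := N) (Finset.mem_univ l)
  simp
  omega

end Orbit

/-! ### Existence of arbitrarily long branches -/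

/-- `T` has a branch which maps `x` to `y`. -/
def Succ (m : Fin 3 → ℝ) (c : ℝ) (x y : Phase) : Prop := ∃ j, Step m c j x y

/-- The state `x` has the energy `c` and the label coordinates `G` and `F`. -/
structure HasLabels (m : Fin 3 → ℝ) (c : ℝ) (x : Phase) (G F : Fin 3 → ℝ) : Prop where
  energy : hamiltonian m x = c
  adm : x ∈ admissible
  pos : labelPos m x = G
  vel : labelVel m x = F

/-- No label is about to penetrate the floor, and, for the mass ratio `1 / 2`, no two labels move
together. -/
structure Outgoing (m : Fin 3 → ℝ) (c : ℝ) (x : Phase) : Prop where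
  energy : hamiltonian m x = c
  adm : x ∈ admissible
  pos : ∀ i, labelPos m x i = 0 → 0 < labelVel m x i
  ne : lowRatio m = 1 / 2 → ∀ i k, i ≠ k → labelPos m x i = labelPos m x k →
    labelVel m x i ≠ labelVel m x k

/-- The state `x` is met at the end of a free flight. -/
structure Incoming (m : Fin 3 → ℝ) (c : ℝ) (x : Phase) : Prop where
  energy : hamiltonian m x = c
  adm : x ∈ admissible
  floor : labelPos m x 0 = 0 → labelVel m x 0 < 0
  le_one : labelPos m x 1 = labelPos m x 0 → labelVel m x 1 ≤ labelVel m x 0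
  le_two : labelPos m x 2 = labelPos m x 1 → labelVel m x 2 ≤ labelVel m x 1
  ne : lowRatio m = 1 / 2 → ∀ i k, i ≠ k → labelPos m x i = labelPos m x k →
    labelVel m x i ≠ labelVel m x k
  due : ∃ j, x ∈ sectionMinus m c j

theorem step_of_mem_sectionMinus {m : Fin 3 → ℝ} {c : ℝ} {j : Fin 3} {x : Phase}
    (hx : x ∈ sectionMinus m c j) : Step m c j x (collision m j x) := by
  refine ⟨0, le_rfl, fun t ht => ?_, fun t ht => absurd ht.2 (not_lt.2 ht.1), ?_, ?_⟩
  · rw [Set.Icc_self, Set.mem_singleton_iff] at ht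
    rw [ht, flow_zero]
    exact hx.2.1
  · rwa [flow_zero]
  · rw [flow_zero]

/-- A collision-free flight can be absorbed into the step that follows it. -/
theorem Step.of_flow {m : Fin 3 → ℝ} (hm : ∀ i, m i ≠ 0) {c : ℝ} {j : Fin 3} {x y : Phase} {τ : ℝ}
    (hτ : 0 ≤ τ) (hadm : ∀ t ∈ Set.Icc 0 τ, flow m t x ∈ admissible)
    (hfree : ∀ t ∈ Set.Ico 0 τ, ∀ k, flow m t x ∉ sectionMinus m c k)
    (hs : Step m c j (flow m τ x) y) : Step m c j x y := by
  obtain ⟨σ, hσ, h1, h2, h3, rfl⟩ := hs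
  have hadd : ∀ t, flow m t x = flow m (t - τ) (flow m τ x) := fun t => by
    rw [flow_add hm]
    congr 1
    ring
  refine ⟨τ + σ, by positivity, fun t ht => ?_, fun t ht => ?_, ?_, ?_⟩
  · rcases le_total t τ with hle | hle
    · exact hadm t ⟨ht.1, hle⟩
    · rw [hadd]
      exact h1 _ ⟨by linarith, by linarith [ht.2]⟩
  · rcases lt_or_ge t τ with hle | hle
    · exact hfree t ⟨ht.1, hle⟩
    · rw [hadd]
      exact h2 _ ⟨by linarith, by linarith [ht.2]⟩
  · rwa [← flow_add hm]
  · rw [← flow_add hm]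

/-- The landing time is the larger root `f + √(f² + 2g)` of the parabola; it is positive because a
label on the floor moves upwards. -/
theorem exists_floor_time {g f : ℝ} (hg : 0 ≤ g) (hf : g = 0 → 0 < f) : ∃ T : ℝ, 0 < T ∧
    (∀ t, 0 ≤ t → t ≤ T → 0 ≤ g + t * f - t ^ 2 / 2) ∧
    (∀ t, 0 ≤ t → t < T → g + t * f - t ^ 2 / 2 = 0 → 0 ≤ f - t) ∧
    g + T * f - T ^ 2 / 2 = 0 ∧ f - T < 0 := by
  have hpos : 0 < f ^ 2 + 2 * g := by
    rcases hg.eq_or_lt with e | e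
    · have := pow_pos (hf e.symm) 2
      linarith
    · have := sq_nonneg f
      linarith
  have hs := Real.sqrt_pos.2 hpos
  have hs2 := Real.sq_sqrt hpos.le
  set s := √(f ^ 2 + 2 * g)
  have habs : |f| ≤ s := Real.abs_le_sqrt (by linarith)
  obtain ⟨h1, h2⟩ := abs_le.1 habs
  refine ⟨f + s, ?_, fun t h3 h4 => ?_, fun t h3 h4 e => ?_, ?_, by linarith⟩
  · refine lt_of_le_of_ne (by linarith) fun e => ?_
    have e1 : g = 0 := by nlinarith
    have := hf e1
    linarith
  · nlinarith [mul_nonneg (show 0 ≤ f + s - t by linarith) (show 0 ≤ t - f + s by linarith)]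
  · by_contra! hlt
    nlinarith [mul_pos (show 0 < f + s - t by linarith) (show 0 < t - f + s by linarith)]
  · nlinarith

/-- Gravity cancels in the difference of two labels, so a gap changes linearly. The closing time is
cut off at a time `T` found before; applied twice, this yields the first collision time. -/
theorem exists_gap_time {g w T : ℝ} (hg : 0 ≤ g) (hw : g = 0 → 0 ≤ w) (hT : 0 < T) :
    ∃ s : ℝ, 0 < s ∧ s ≤ T ∧ (∀ t, 0 ≤ t → t ≤ s → 0 ≤ g + t * w) ∧
      (∀ t, 0 ≤ t → t < s → g + t * w = 0 → 0 ≤ w) ∧ (s = T ∨ g + s * w = 0 ∧ w < 0) := by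
  rcases le_or_gt 0 w with h0 | h0
  · exact ⟨T, hT, le_rfl, fun t ht _ => by positivity, fun _ _ _ _ => h0, Or.inl rfl⟩
  · have hg' : 0 < g := lt_of_le_of_ne hg fun e => (hw e.symm).not_gt h0
    have hd : 0 < g / -w := div_pos hg' (neg_pos.2 h0)
    have he : g / -w * w = -g := by
      rw [div_neg, neg_mul, div_mul_cancel₀ _ h0.ne]
    refine ⟨min T (g / -w), lt_min hT hd, min_le_left _ _, fun t _ ht => ?_, fun t _ ht e => ?_, ?_⟩
    · have := ht.trans (min_le_right _ _)
      nlinarith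
    · have := ht.trans_le (min_le_right _ _)
      nlinarith
    · rcases min_choice T (g / -w) with e | e
      · exact Or.inl e
      · rw [e]
        exact Or.inr ⟨by linarith, h0⟩

/-! ### Free flights and the resolution of multiple collisions -/

section Moves

variable {m : Fin 3 → ℝ} (h : WideMasses m) {c : ℝ} {x : Phase} {G : Fin 3 → ℝ} {f0 f1 f2 : ℝ}
include h

theorem HasLabels.floor (hx : HasLabels m c x G ![f0, f1, f2]) (hG : G 0 = 0) (hf : f0 < 0) :
    ∃ y, Succ m c x y ∧
      HasLabels m c y G ![-f0, f1 - 2 * lowRatio m * f0, f2 - 2 * lowRatio m * f0] := by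
  have hmem : x ∈ sectionMinus m c 0 := mem_sectionMinus_zero.2
    ⟨hx.energy, hx.adm, by rw [hx.pos, hG], by rw [hx.vel]; exact hf⟩
  refine ⟨_, ⟨0, step_of_mem_sectionMinus hmem⟩, by rw [hamiltonian_collision h.pos_all, hx.energy],
    hx.adm, hx.pos, ?_⟩
  ext i
  rw [labelVel_collision_zero, hx.vel]
  fin_cases i <;> rfl

theorem HasLabels.swap_one (hx : HasLabels m c x G ![f0, f1, f2]) (hG : G 1 = G 0) (hf : f1 < f0) :
    ∃ y, Succ m c x y ∧ HasLabels m c y G ![f1, f0, f2] := by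
  have hmem : x ∈ sectionMinus m c 1 := h.mem_sectionMinus_one.2
    ⟨hx.energy, hx.adm, by rw [hx.pos, hG], by rw [hx.vel]; exact hf⟩
  refine ⟨_, ⟨1, step_of_mem_sectionMinus hmem⟩, by rw [hamiltonian_collision h.pos_all, hx.energy],
    hx.adm, hx.pos, ?_⟩
  ext i
  obtain ⟨i, rfl⟩ := (mirror 1).surjective i
  rw [h.labelVel_collision_one, hx.vel]
  fin_cases i <;> rfl

theorem HasLabels.swap_two (hx : HasLabels m c x G ![f0, f1, f2]) (hG : G 2 = G 1) (hf : f2 < f1) :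
    ∃ y, Succ m c x y ∧ HasLabels m c y G ![f0, f2, f1] := by
  have hmem : x ∈ sectionMinus m c 2 := h.mem_sectionMinus_two.2
    ⟨hx.energy, hx.adm, by rw [hx.pos, hG], by rw [hx.vel]; exact hf⟩
  refine ⟨_, ⟨2, step_of_mem_sectionMinus hmem⟩, by rw [hamiltonian_collision h.pos_all, hx.energy],
    hx.adm, hx.pos, ?_⟩
  ext i
  obtain ⟨i, rfl⟩ := (mirror 2).surjective i
  rw [h.labelVel_collision_two, hx.vel]
  fin_cases i <;> rfl

theorem exists_labels_mirror {j : Fin 3} (hj : j ≠ 0) (hx : x ∈ sectionMinus m c j) (i : Fin 3) :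
    labelPos m (collision m j x) (mirror j i) = labelPos m x i ∧
      labelVel m (collision m j x) (mirror j i) = labelVel m x i := by
  have hj : j = 1 ∨ j = 2 := by
    revert hj
    fin_cases j <;> simp
  rcases hj with rfl | rfl
  · obtain ⟨-, -, h0, -⟩ := h.mem_sectionMinus_one.1 hx
    refine ⟨?_, h.labelVel_collision_one x i⟩
    rw [labelPos_collision]
    fin_cases i <;> simp [mirror, Equiv.swap_apply_def, h0]
  · obtain ⟨-, -, h0, -⟩ := h.mem_sectionMinus_two.1 hx
    refine ⟨?_, h.labelVel_collision_two x i⟩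
    rw [labelPos_collision]
    fin_cases i <;> simp [mirror, Equiv.swap_apply_def, h0]

/-- A ball-ball collision preserves every property of the set of the labels. -/
theorem outgoing_collision {j : Fin 3} (hj : j ≠ 0) (hx : x ∈ sectionMinus m c j)
    (hpos : ∀ i, labelPos m x i = 0 → 0 < labelVel m x i)
    (hne : lowRatio m = 1 / 2 → ∀ i k, i ≠ k → labelPos m x i = labelPos m x k →
      labelVel m x i ≠ labelVel m x k) : Outgoing m c (collision m j x) := by
  have hl := exists_labels_mirror h hj hx
  refine ⟨by rw [hamiltonian_collision h.pos_all, hx.1], hx.2.1, fun i => ?_, fun hg i k => ?_⟩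
  · obtain ⟨i, rfl⟩ := (mirror j).surjective i
    rw [(hl i).1, (hl i).2]
    exact hpos i
  · obtain ⟨i, rfl⟩ := (mirror j).surjective i
    obtain ⟨k, rfl⟩ := (mirror j).surjective k
    rw [(hl i).1, (hl i).2, (hl k).1, (hl k).2]
    exact fun hik => hne hg i k fun e => hik (e ▸ rfl)

omit h in
theorem HasLabels.outgoing (hx : HasLabels m c x G ![f0, f1, f2])
    (h0 : G 0 = 0 → 0 < f0) (h1 : G 1 = 0 → 0 < f1) (h2 : G 2 = 0 → 0 < f2)
    (h01 : lowRatio m = 1 / 2 → G 0 = G 1 → f0 ≠ f1)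
    (h02 : lowRatio m = 1 / 2 → G 0 = G 2 → f0 ≠ f2)
    (h12 : lowRatio m = 1 / 2 → G 1 = G 2 → f1 ≠ f2) : Outgoing m c x := by
  refine ⟨hx.energy, hx.adm, fun i => ?_, fun hg i k => ?_⟩
  · rw [hx.pos, hx.vel]
    fin_cases i
    exacts [h0, h1, h2]
  · rw [hx.pos, hx.vel]
    have h01 := h01 hg
    have h02 := h02 hg
    have h12 := h12 hg
    fin_cases i <;> fin_cases k <;> intro hik e
    exacts [absurd rfl hik, h01 e, h02 e, (h01 e.symm).symm, absurd rfl hik, h12 e,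
      (h02 e.symm).symm, (h12 e.symm).symm, absurd rfl hik]

/-- For `γ > 1/2`, the faster falling label is sent to the floor first, and its kick turns the other
one upwards as well. For `γ ≤ 1/2`, the lower, slower one hits first; the other still falls, moves
down and hits too. For `γ = 1/2` and equal velocities the second label would be left at rest on the
floor, a dead end, which is why `Outgoing` and `Incoming` exclude coincident labels in that case. -/
theorem exists_outgoing_of_edge (hx : HasLabels m c x G ![f0, f1, f2]) (hG0 : G 0 = 0)
    (hG1 : G 1 = 0) (hG2 : 0 < G 2) (hf0 : f0 < 0) (hf1 : f1 ≤ f0)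
    (hlt : lowRatio m = 1 / 2 → f1 < f0) :
    ∃ y, Outgoing m c y ∧ Relation.TransGen (Succ m c) x y := by
  have g0 := h.lowRatio_pos
  rcases lt_or_ge (1 / 2) (lowRatio m) with hg | hg
  · rcases hf1.eq_or_lt with e | e
    · obtain ⟨y, hy, hl⟩ := hx.floor h hG0 hf0
      refine ⟨y, hl.outgoing (fun _ => neg_pos.2 hf0) (fun _ => ?_) (fun e => absurd e hG2.ne')
        (fun e => absurd e hg.ne') (fun e => absurd e hg.ne') (fun e => absurd e hg.ne'),
        .single hy⟩
      nlinarith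
    · obtain ⟨y, hy, hl⟩ := hx.swap_one h (hG1.trans hG0.symm) e
      obtain ⟨z, hz, hl⟩ := hl.floor h hG0 (by linarith)
      refine ⟨z, hl.outgoing (fun _ => by linarith) (fun _ => ?_) (fun e => absurd e hG2.ne')
        (fun e => absurd e hg.ne') (fun e => absurd e hg.ne') (fun e => absurd e hg.ne'),
        .tail (.single hy) hz⟩
      nlinarith
  · have hY : f1 - 2 * lowRatio m * f0 < 0 := by
      rcases hg.eq_or_lt with e | e
      · have := hlt e
        rw [e]
        linarith
      · nlinarith
    obtain ⟨y, hy, hl⟩ := hx.floor h hG0 hf0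
    obtain ⟨z, hz, hl⟩ := hl.swap_one h (hG1.trans hG0.symm) (by linarith)
    obtain ⟨u, hu, hl⟩ := hl.floor h hG0 hY
    refine ⟨u, hl.outgoing (fun _ => by linarith) (fun _ => by nlinarith)
      (fun e => absurd e hG2.ne') (fun hg _ => ?_) (fun _ e => absurd (e.symm.trans hG0) hG2.ne')
      (fun _ e => absurd (e.symm.trans hG1) hG2.ne'), .tail (.tail (.single hy) hz) hu⟩
    rw [hg]
    intro e
    linarith

/-- For `γ > 1/2` one hit by the fastest falling label turns all labels upwards. For `γ ≤ 1/2` each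
label hits once, from the slowest to the fastest; the kicks leave the waiting labels falling. -/
theorem exists_outgoing_of_vertex (hx : HasLabels m c x G ![f0, f1, f2]) (hG0 : G 0 = 0)
    (hG1 : G 1 = 0) (hG2 : G 2 = 0) (hf0 : f0 < 0) (hf1 : f1 ≤ f0) (hf2 : f2 ≤ f1)
    (hlt1 : lowRatio m = 1 / 2 → f1 < f0) (hlt2 : lowRatio m = 1 / 2 → f2 < f1) :
    ∃ y, Outgoing m c y ∧ Relation.TransGen (Succ m c) x y := by
  have g0 := h.lowRatio_pos
  have hG10 := hG1.trans hG0.symm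
  have hG21 := hG2.trans hG1.symm
  rcases lt_or_ge (1 / 2) (lowRatio m) with hg | hg
  · have key : ∀ {y : Phase} {a b d : ℝ}, HasLabels m c y G ![a, b, d] → a < 0 → a ≤ b → a ≤ d →
        ∃ z, Outgoing m c z ∧ Succ m c y z := fun hy ha hab had => by
      obtain ⟨z, hz, hl⟩ := hy.floor h hG0 ha
      refine ⟨z, hl.outgoing (fun _ => neg_pos.2 ha) (fun _ => ?_) (fun _ => ?_)
        (fun e => absurd e hg.ne') (fun e => absurd e hg.ne') (fun e => absurd e hg.ne'), hz⟩ <;>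
      nlinarith
    rcases hf2.eq_or_lt with e2 | e2
    · rcases hf1.eq_or_lt with e1 | e1
      · obtain ⟨z, hz, hxz⟩ := key hx hf0 e1.ge (by linarith)
        exact ⟨z, hz, .single hxz⟩
      · obtain ⟨y, hy, hl⟩ := hx.swap_one h hG10 e1
        obtain ⟨z, hz, hyz⟩ := key hl (by linarith) hf1 e2.ge
        exact ⟨z, hz, .tail (.single hy) hyz⟩
    · obtain ⟨y, hy, hl⟩ := hx.swap_two h hG21 e2
      obtain ⟨u, hu, hl⟩ := hl.swap_one h hG10 (by linarith)
      obtain ⟨z, hz, huz⟩ := key hl (by linarith) (by linarith) hf2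
      exact ⟨z, hz, .tail (.tail (.single hy) hu) huz⟩
  · have hY : f1 - 2 * lowRatio m * f0 < 0 := by
      rcases hg.eq_or_lt with e | e
      · have := hlt1 e
        rw [e]
        linarith
      · nlinarith
    -- The velocity of the third label after two kicks. It is at most `1 - 2γ` times the negative
    -- number in `hY`, and for `γ = 1/2` it equals `f2 - f1`.
    have hW : f2 - 2 * lowRatio m * f0 - 2 * lowRatio m * (f1 - 2 * lowRatio m * f0) < 0 := by
      rcases hg.eq_or_lt with e | e
      · have := hlt2 e
        rw [e]
        linarith
      · nlinarith
    obtain ⟨y1, h1, hl⟩ := hx.floor h hG0 hf0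
    obtain ⟨y2, h2, hl⟩ := hl.swap_one h hG10 (by linarith)
    obtain ⟨y3, h3, hl⟩ := hl.floor h hG0 hY
    obtain ⟨y4, h4, hl⟩ := hl.swap_two h hG21 (by nlinarith)
    obtain ⟨y5, h5, hl⟩ := hl.swap_one h hG10 (by linarith)
    obtain ⟨y6, h6, hl⟩ := hl.floor h hG0 hW
    refine ⟨y6, hl.outgoing (fun _ => by linarith) (fun _ => by nlinarith) (fun _ => by nlinarith)
      (fun hg _ => ?_) (fun hg _ => ?_) (fun hg _ => ?_),
      .tail (.tail (.tail (.tail (.tail (.single h1) h2) h3) h4) h5) h6⟩ <;>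
    · have := hlt1 hg
      have := hlt2 hg
      rw [hg]
      intro e
      linarith

/-- The state at the end of a free flight. -/
theorem Outgoing.exists_incoming (hx : Outgoing m c x) (hfree : ∀ j, x ∉ sectionMinus m c j) :
    ∃ τ : ℝ, 0 ≤ τ ∧ (∀ t ∈ Set.Icc 0 τ, flow m t x ∈ admissible) ∧
      (∀ t ∈ Set.Ico 0 τ, ∀ k, flow m t x ∉ sectionMinus m c k) ∧ Incoming m c (flow m τ x) := by
  have hm := h.ne_zero
  obtain ⟨g0, g1, g2⟩ := (h.mem_admissible_iff x).1 hx.adm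
  have d1 : labelPos m x 1 = labelPos m x 0 → labelVel m x 0 ≤ labelVel m x 1 := fun e =>
    not_lt.1 fun hlt => hfree 1 (h.mem_sectionMinus_one.2 ⟨hx.energy, hx.adm, e, hlt⟩)
  have d2 : labelPos m x 2 = labelPos m x 1 → labelVel m x 1 ≤ labelVel m x 2 := fun e =>
    not_lt.1 fun hlt => hfree 2 (h.mem_sectionMinus_two.2 ⟨hx.energy, hx.adm, e, hlt⟩)
  have hp0 := hx.pos 0
  have hG : ∀ t i, labelPos m (flow m t x) i = labelPos m x i + t * labelVel m x i - t ^ 2 / 2 :=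
    fun t i => labelPos_flow t x i
  have hF : ∀ t i, labelVel m (flow m t x) i = labelVel m x i - t :=
    fun t i => labelVel_flow hm t x i
  have hH : ∀ t, hamiltonian m (flow m t x) = c := fun t => by rw [hamiltonian_flow hm, hx.energy]
  have hne : lowRatio m = 1 / 2 → ∀ t i k, i ≠ k →
      labelPos m (flow m t x) i = labelPos m (flow m t x) k →
      labelVel m (flow m t x) i ≠ labelVel m (flow m t x) k := by
    intro hg t i k hik e1 e2
    simp only [hG, hF, sub_left_inj] at e1 e2
    rw [e2] at e1
    exact hx.ne hg i k hik (by linarith) e2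
  obtain ⟨T, hT, hT1, hT2, hT3⟩ := exists_floor_time g0 hp0
  obtain ⟨s, hs, hsT, hs1, hs2, hs3⟩ := exists_gap_time (sub_nonneg.2 g1)
    (fun e => sub_nonneg.2 (d1 (sub_eq_zero.1 e))) hT
  obtain ⟨τ, hτ, hτs, hτ1, hτ2, hτ3⟩ := exists_gap_time (sub_nonneg.2 g2)
    (fun e => sub_nonneg.2 (d2 (sub_eq_zero.1 e))) hs
  have hadm : ∀ t ∈ Set.Icc 0 τ, flow m t x ∈ admissible := fun t ht => by
    have h1 := hs1 t ht.1 (ht.2.trans hτs)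
    have h2 := hτ1 t ht.1 ht.2
    rw [h.mem_admissible_iff, hG, hG, hG]
    exact ⟨hT1 t ht.1 (ht.2.trans (hτs.trans hsT)), by linarith, by linarith⟩
  refine ⟨τ, hτ.le, hadm, fun t ht k hk => ?_, hH τ, hadm τ ⟨hτ.le, le_rfl⟩, fun e => ?_,
    fun e => ?_, fun e => ?_, fun hg => hne hg τ, ?_⟩
  · have hk3 : k = 0 ∨ k = 1 ∨ k = 2 := by
      fin_cases k <;> simp
    rcases hk3 with rfl | rfl | rfl
    · obtain ⟨-, -, e, hlt⟩ := mem_sectionMinus_zero.1 hk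
      rw [hG] at e
      rw [hF] at hlt
      exact (hT2 t ht.1 (ht.2.trans_le (hτs.trans hsT)) e).not_gt hlt
    · obtain ⟨-, -, e, hlt⟩ := h.mem_sectionMinus_one.1 hk
      rw [hG, hG] at e
      rw [hF, hF] at hlt
      exact (hs2 t ht.1 (ht.2.trans_le hτs) (by linarith)).not_gt (by linarith)
    · obtain ⟨-, -, e, hlt⟩ := h.mem_sectionMinus_two.1 hk
      rw [hG, hG] at e
      rw [hF, hF] at hlt
      exact (hτ2 t ht.1 ht.2 (by linarith)).not_gt (by linarith)
  -- A label on the floor at time `τ > 0` that was not falling would have started below the floor.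
  · rw [hG] at e
    rw [hF]
    by_contra! hge
    rcases g0.eq_or_lt with e0 | e0
    · have := hp0 e0.symm
      nlinarith
    · nlinarith
  · rw [hG, hG] at e
    rw [hF, hF]
    nlinarith
  · rw [hG, hG] at e
    rw [hF, hF]
    nlinarith
  · have hτ' := hadm τ ⟨hτ.le, le_rfl⟩
    rcases hτ3 with e | ⟨e, hlt⟩
    · rcases hs3 with e' | ⟨e', hlt⟩
      · refine ⟨0, mem_sectionMinus_zero.2 ⟨hH τ, hτ', ?_, ?_⟩⟩
        · rw [hG, e, e']
          exact hT3.1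
        · rw [hF, e, e']
          exact hT3.2
      · refine ⟨1, h.mem_sectionMinus_one.2 ⟨hH τ, hτ', ?_, ?_⟩⟩
        · rw [hG, hG, e]
          linarith
        · rw [hF, hF]
          linarith
    · refine ⟨2, h.mem_sectionMinus_two.2 ⟨hH τ, hτ', ?_, ?_⟩⟩
      · rw [hG, hG]
        linarith
      · rw [hF, hF]
        linarith

/-- From the end of a free flight, a branch leads back to an outgoing state at the same time. -/
theorem Incoming.exists_outgoing (hx : Incoming m c x) :
    ∃ y, Outgoing m c y ∧ Relation.TransGen (Succ m c) x y := by
  obtain ⟨p0, p1, p2⟩ := (h.mem_admissible_iff x).1 hx.adm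
  have hfloor := hx.floor
  have hle1 := hx.le_one
  have hle2 := hx.le_two
  have hne := hx.ne
  have hl : HasLabels m c x (labelPos m x)
      ![labelVel m x 0, labelVel m x 1, labelVel m x 2] :=
    ⟨hx.energy, hx.adm, rfl, by ext i; fin_cases i <;> rfl⟩
  rcases p0.eq_or_lt with e0 | e0
  · have f0 := hfloor e0.symm
    rcases p1.eq_or_lt with e1 | e1
    · have f1 := hle1 e1.symm
      rcases p2.eq_or_lt with e2 | e2
      · have f2 := hle2 e2.symm
        exact exists_outgoing_of_vertex h hl e0.symm (e1.symm.trans e0.symm)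
          (e2.symm.trans (e1.symm.trans e0.symm)) f0 f1 f2
          (fun hg => lt_of_le_of_ne f1 (hne hg 1 0 (by decide) e1.symm))
          (fun hg => lt_of_le_of_ne f2 (hne hg 2 1 (by decide) e2.symm))
      · exact exists_outgoing_of_edge h hl e0.symm (e1.symm.trans e0.symm)
          (by linarith) f0 f1
          (fun hg => lt_of_le_of_ne f1 (hne hg 1 0 (by decide) e1.symm))
    · obtain ⟨y, hy, hl'⟩ := hl.floor h e0.symm f0
      refine ⟨y, hl'.outgoing ?_ ?_ ?_ ?_ ?_ ?_, .single hy⟩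
      · exact fun _ => neg_pos.2 f0
      · exact fun e => absurd e (by linarith)
      · exact fun e => absurd e (by linarith)
      · exact fun _ e => absurd e (by linarith)
      · exact fun _ e => absurd e (by linarith)
      · exact fun hg e => fun e' => hne hg 1 2 (by decide) e (by linarith)
  · obtain ⟨j, hj⟩ := hx.due
    have hj0 : j ≠ 0 := by
      rintro rfl
      exact e0.ne' (mem_sectionMinus_zero.1 hj).2.2.1
    refine ⟨_, outgoing_collision h hj0 hj (fun i e => absurd e ?_) hne,
      .single ⟨j, step_of_mem_sectionMinus hj⟩⟩
    fin_cases i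
    exacts [e0.ne', (e0.trans_le p1).ne', (e0.trans_le (p1.trans p2)).ne']

/-- Either a ball-ball collision is due at once, and exchanging labels keeps the state outgoing, or
there is a free flight to an incoming state, which is absorbed into the first step of the resolving
branch. -/
theorem Outgoing.exists_outgoing (hx : Outgoing m c x) :
    ∃ y, Outgoing m c y ∧ Relation.TransGen (Succ m c) x y := by
  by_cases hfree : ∀ j, x ∉ sectionMinus m c j
  · obtain ⟨τ, hτ, h1, h2, h3⟩ := hx.exists_incoming h hfree
    obtain ⟨y, hy, hxy⟩ := h3.exists_outgoing h
    obtain ⟨z, ⟨j, hz⟩, hzy⟩ := Relation.TransGen.head'_iff.1 hxy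
    exact ⟨y, hy, Relation.TransGen.head'_iff.2 ⟨z, ⟨j, hz.of_flow h.ne_zero hτ h1 h2⟩, hzy⟩⟩
  · push Not at hfree
    obtain ⟨j, hj⟩ := hfree
    have hj0 : j ≠ 0 := by
      rintro rfl
      obtain ⟨-, -, e, hlt⟩ := mem_sectionMinus_zero.1 hj
      exact (hx.pos 0 e).not_gt hlt
    exact ⟨_, outgoing_collision h hj0 hj hx.pos hx.ne, .single ⟨j, step_of_mem_sectionMinus hj⟩⟩

omit h in
theorem exists_isBranch_of_transGen {y : Phase} {n : ℕ} (hxy : Relation.TransGen (Succ m c) x y)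
    (hy : ∃ w : List (Fin 3), w.length = n ∧ IsBranch m c w y) :
    ∃ w : List (Fin 3), w.length = n + 1 ∧ IsBranch m c w x := by
  induction hxy using Relation.TransGen.head_induction_on with
  | single hs =>
    obtain ⟨j, hs⟩ := hs
    obtain ⟨w, hw, hb⟩ := hy
    exact ⟨j :: w, by simp [hw], _, hs, hb⟩
  | head hs _ ih =>
    obtain ⟨j, hs⟩ := hs
    obtain ⟨w, hw, hb⟩ := ih
    -- The branch found may be longer than required, so its end is cut off.
    exact ⟨j :: w.take n, by simp [hw], _, hs, hb.take n⟩

theorem Outgoing.exists_isBranch (hx : Outgoing m c x) (n : ℕ) :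
    ∃ w : List (Fin 3), w.length = n ∧ IsBranch m c w x := by
  induction n generalizing x with
  | zero => exact ⟨[], rfl, trivial⟩
  | succ n ih =>
    obtain ⟨y, hy, hxy⟩ := hx.exists_outgoing h
    exact exists_isBranch_of_transGen hxy (ih hy)

/-- Outgoing states of the Poincaré section are least expanding. -/
theorem Outgoing.mem_leastExpanding (hx : Outgoing m c x) (hx' : x ∈ phaseSpace m c) :
    x ∈ leastExpanding m c := by
  obtain ⟨n, hn⟩ := exists_forall_mem_hits h hx.energy hx.adm
  exact FallingBalls.mem_leastExpanding h hx' (hx.exists_isBranch h) hn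

end Moves

/-! ### Regular states of the Poincaré section -/

/-- The states of `𝓜ⱼ⁺` in which every closed gap is opening. -/
def regularSection (m : Fin 3 → ℝ) (c : ℝ) (j : Fin 3) : Set Phase :=
  {x | hamiltonian m x = c ∧ (∀ k, 0 ≤ gap k x) ∧ gap j x = 0 ∧
    ∀ k, gap k x = 0 → 0 < gapVel m k x}

theorem mem_admissible_iff_gap {x : Phase} : x ∈ admissible ↔ ∀ k, 0 ≤ gap k x := by
  simp [admissible, gap, Fin.forall_fin_succ]

/-- Labels at the same position have strictly increasing velocities, and the lowest label moves
upwards if it is on the floor. So the state is outgoing, even if several gaps are closed. -/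
theorem WideMasses.regularSection_subset {m : Fin 3 → ℝ} (h : WideMasses m) (c : ℝ) (j : Fin 3) :
    regularSection m c j ⊆ leastExpanding m c := by
  rintro x ⟨hH, hadm, hgap, hvel⟩
  rw [← mem_admissible_iff_gap] at hadm
  refine Outgoing.mem_leastExpanding h ?_
    (Set.mem_iUnion.2 ⟨j, hH, hadm, hgap, (hvel j hgap).le⟩)
  obtain ⟨p0, p1, p2⟩ := (h.mem_admissible_iff x).1 hadm
  have g1 := sub_pos.2 h.lowRatio_lt_one
  have u1 := sub_pos.2 h.upRatio_lt_one
  have h0 : labelPos m x 0 = 0 → 0 < labelVel m x 0 := hvel 0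
  have h1 : labelPos m x 1 = labelPos m x 0 → labelVel m x 0 < labelVel m x 1 := fun e => by
    have h1 : 0 < vel m x 1 - vel m x 0 := hvel 1 (sub_eq_zero.2 ((h.labels_eq_one _).1 e))
    rw [← sub_pos, labelVel, labels_one_sub]
    positivity
  have h2 : labelPos m x 2 = labelPos m x 1 → labelVel m x 1 < labelVel m x 2 := fun e => by
    have h1 : 0 < vel m x 2 - vel m x 1 := hvel 2 (sub_eq_zero.2 ((h.labels_eq_two _).1 e))
    rw [← sub_pos, labelVel, labels_two_sub]
    positivity
  have hl : HasLabels m c x (labelPos m x) ![labelVel m x 0, labelVel m x 1, labelVel m x 2] :=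
    ⟨hH, hadm, rfl, by ext i; fin_cases i <;> rfl⟩
  have h1' : labelPos m x 1 = 0 → 0 < labelVel m x 1 := fun e => by
    have e0 : labelPos m x 0 = 0 := by linarith
    exact (h0 e0).trans (h1 (e.trans e0.symm))
  refine hl.outgoing h0 h1' (fun e => ?_) (fun _ e => (h1 e.symm).ne) (fun _ e => ?_)
    (fun _ e => (h2 e.symm).ne)
  · have e1 : labelPos m x 1 = 0 := by linarith
    exact (h1' e1).trans (h2 (e.trans e1.symm))
  · have e1 : labelPos m x 1 = labelPos m x 0 := by linarith
    exact ((h1 e1).trans (h2 (e.symm.trans e1.symm))).ne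

/-! ### Connectedness -/

/-- The state with the gaps `g k` which open at unit speed. -/
def openingState (m : Fin 3 → ℝ) (g : Fin 3 → ℝ) : Phase :=
  (![g 0, g 0 + g 1, g 0 + g 1 + g 2], ![m 0, 2 * m 1, 3 * m 2])

theorem gap_openingState (m g : Fin 3 → ℝ) (k : Fin 3) : gap k (openingState m g) = g k := by
  fin_cases k <;> simp [gap, openingState]

theorem gapVel_openingState {m : Fin 3 → ℝ} (hm : ∀ i, m i ≠ 0) (g : Fin 3 → ℝ) (k : Fin 3) :
    gapVel m k (openingState m g) = 1 := by
  have h0 := hm 0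
  have h1 := hm 1
  have h2 := hm 2
  fin_cases k <;> simp [gapVel, openingState, vel, h0, h1, h2] <;> norm_num

theorem gap_add_smul (k : Fin 3) (s t : ℝ) (x y : Phase) :
    gap k (s • x + t • y) = s * gap k x + t * gap k y := by
  fin_cases k <;> simp [gap] <;> ring

theorem gapVel_add_smul (m : Fin 3 → ℝ) (k : Fin 3) (s t : ℝ) (x y : Phase) :
    gapVel m k (s • x + t • y) = s * gapVel m k x + t * gapVel m k y := by
  fin_cases k <;> simp [gapVel, vel] <;> ring

/-- The scaling `(q, p) ↦ (r² q, r p)` to the energy `c`. -/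
def rescale (m : Fin 3 → ℝ) (c : ℝ) (x : Phase) : Phase :=
  ((c / hamiltonian m x) • x.1, √(c / hamiltonian m x) • x.2)

theorem hamiltonian_rescale {m : Fin 3 → ℝ} {c : ℝ} (hc : 0 < c) {x : Phase}
    (hx : 0 < hamiltonian m x) : hamiltonian m (rescale m c x) = c := by
  have h1 : ∀ r : ℝ, 0 ≤ r → hamiltonian m (r • x.1, √r • x.2) = r * hamiltonian m x :=
    fun r hr => by
      rw [hamiltonian, hamiltonian, Finset.mul_sum]
      refine Finset.sum_congr rfl fun i _ => ?_
      simp only [Pi.smul_apply, smul_eq_mul, mul_pow, Real.sq_sqrt hr]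
      ring
  rw [rescale, h1 _ (div_pos hc hx).le, div_mul_cancel₀ _ hx.ne']

theorem gap_rescale (m : Fin 3 → ℝ) (c : ℝ) (k : Fin 3) (x : Phase) :
    gap k (rescale m c x) = c / hamiltonian m x * gap k x := by
  fin_cases k <;> simp [gap, rescale] <;> ring

theorem gapVel_rescale (m : Fin 3 → ℝ) (c : ℝ) (k : Fin 3) (x : Phase) :
    gapVel m k (rescale m c x) = √(c / hamiltonian m x) * gapVel m k x := by
  fin_cases k <;> simp [gapVel, vel, rescale] <;> ring

theorem rescale_of_energy {m : Fin 3 → ℝ} {c : ℝ} (hc : c ≠ 0) {x : Phase}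
    (hx : hamiltonian m x = c) : rescale m c x = x := by
  simp [rescale, hx, div_self hc]

theorem continuous_hamiltonian (m : Fin 3 → ℝ) : Continuous (hamiltonian m) := by
  unfold hamiltonian
  simp only [div_eq_mul_inv]
  fun_prop

theorem continuousOn_rescale (m : Fin 3 → ℝ) (c : ℝ) :
    ContinuousOn (rescale m c) {x | 0 < hamiltonian m x} := by
  have h1 : ContinuousOn (fun x => c / hamiltonian m x) {x | 0 < hamiltonian m x} :=
    continuousOn_const.div (continuous_hamiltonian m).continuousOn fun x hx => ne_of_gt hx
  exact (h1.smul continuous_fst.continuousOn).prodMk (h1.sqrt.smul continuous_snd.continuousOn)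

theorem hamiltonian_pos {m : Fin 3 → ℝ} (hm : ∀ i, 0 < m i) {x : Phase} (hx : ∀ k, 0 ≤ gap k x)
    (h : ∃ k, 0 < gap k x) : 0 < hamiltonian m x := by
  obtain ⟨k, hk⟩ := h
  have h0 : 0 ≤ x.1 0 := hx 0
  have h1 : 0 ≤ x.1 1 - x.1 0 := hx 1
  have h2 : 0 ≤ x.1 2 - x.1 1 := hx 2
  have h3 : 0 < x.1 2 := by
    fin_cases k <;> simp [gap] at hk <;> linarith
  have e : ∀ i, 0 ≤ x.1 i → 0 ≤ x.2 i ^ 2 / (2 * m i) + m i * x.1 i := fun i hi => by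
    have := hm i
    positivity
  have e2 : 0 < x.2 2 ^ 2 / (2 * m 2) + m 2 * x.1 2 := by
    have := hm 2
    positivity
  rw [hamiltonian, Fin.sum_univ_three]
  linarith [e 0 h0, e 1 (by linarith)]

theorem rescale_mem_regularSection {m : Fin 3 → ℝ} (hm : ∀ i, 0 < m i) {c : ℝ} (hc : 0 < c)
    {j : Fin 3} {x : Phase} (h0 : ∀ k, 0 ≤ gap k x) (h1 : ∃ k, 0 < gap k x) (hj : gap j x = 0)
    (hv : ∀ k, gap k x = 0 → 0 < gapVel m k x) : rescale m c x ∈ regularSection m c j := by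
  have hx := hamiltonian_pos hm h0 h1
  have hr := div_pos hc hx
  have hs := Real.sqrt_pos.2 hr
  refine ⟨hamiltonian_rescale hc hx, fun k => ?_, ?_, fun k hk => ?_⟩
  · rw [gap_rescale]
    exact mul_nonneg hr.le (h0 k)
  · rw [gap_rescale, hj, mul_zero]
  · rw [gap_rescale, mul_eq_zero, or_iff_right hr.ne'] at hk
    rw [gapVel_rescale]
    exact mul_pos hs (hv k hk)

/-- The point of `𝓜ⱼ⁺` which sees all other points of `𝓜ⱼ⁺`. -/
def centre (m : Fin 3 → ℝ) (c : ℝ) (j : Fin 3) : Phase :=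
  rescale m c (openingState m fun k => if k = j then 0 else 1)

/-- Gaps and their velocities are linear in `(q, p)`. On the segment to the opening state, gap `j`
stays closed but opens with positive velocity, and the other gaps are positive as soon as `t > 0`.
Rescaling to the energy `c` preserves these signs; only the starting point needs the hypothesis that
it is least expanding. -/
theorem joinedIn_centre {m : Fin 3 → ℝ} (h : WideMasses m) {c : ℝ} (hc : 0 < c) {j : Fin 3}
    {x : Phase} (hx : x ∈ sectionPlus m c j) (hx' : x ∈ leastExpanding m c) :
    JoinedIn (leastExpanding m c) x (centre m c j) := by
  obtain ⟨hH, hadm, hgap, hvel⟩ := hx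
  rw [mem_admissible_iff_gap] at hadm
  set y := openingState m fun k => if k = j then 0 else 1 with hy
  let f : ℝ → Phase := fun t => (1 - t) • x + t • y
  have hcont : Continuous f := by fun_prop
  have hf0 : f 0 = x := by simp [f]
  have hgapf : ∀ t k, gap k (f t) = (1 - t) * gap k x + t * if k = j then 0 else 1 := fun t k => by
    rw [gap_add_smul, hy, gap_openingState]
  have h0 : ∀ t ∈ unitInterval, ∀ k, 0 ≤ gap k (f t) := fun t ht k => by
    rw [hgapf]
    have := mul_nonneg (sub_nonneg.2 ht.2) (hadm k)
    have := ht.1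
    split_ifs <;> linarith
  have h1 : ∀ t ∈ unitInterval, 0 < t → ∀ k, k ≠ j → 0 < gap k (f t) := fun t ht htpos k hk => by
    rw [hgapf, if_neg hk]
    have := mul_nonneg (sub_nonneg.2 ht.2) (hadm k)
    linarith
  have hj : ∀ t, gap j (f t) = 0 := fun t => by
    rw [hgapf, if_pos rfl, hgap]
    ring
  have hv : ∀ t ∈ unitInterval, 0 < t → 0 < gapVel m j (f t) := fun t ht htpos => by
    rw [gapVel_add_smul, hy, gapVel_openingState h.ne_zero]
    have := mul_nonneg (sub_nonneg.2 ht.2) hvel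
    linarith
  obtain ⟨i, hi⟩ : ∃ i : Fin 3, i ≠ j := exists_ne j
  have hpos : ∀ t ∈ unitInterval, 0 < hamiltonian m (f t) := fun t ht => by
    rcases ht.1.eq_or_lt with e | e
    · rw [← e, hf0, hH]
      exact hc
    · exact hamiltonian_pos h.pos_all (h0 t ht) ⟨i, h1 t ht e i hi⟩
  refine JoinedIn.ofLine (f := fun t => rescale m c (f t))
    ((continuousOn_rescale m c).comp hcont.continuousOn hpos) ?_ ?_ ?_
  · simp only [hf0]
    exact rescale_of_energy hc.ne' hH
  · simp [f, centre, hy]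
  · rintro _ ⟨t, ht, rfl⟩
    rcases ht.1.eq_or_lt with e | e
    · simp only [← e, hf0]
      rwa [rescale_of_energy hc.ne' hH]
    · refine h.regularSection_subset c j (rescale_mem_regularSection h.pos_all hc (h0 t ht)
        ⟨i, h1 t ht e i hi⟩ (hj t) fun k hk => ?_)
      have : k = j := by
        by_contra hkj
        exact (h1 t ht e k hkj).ne' hk
      rw [this]
      exact hv t ht e

theorem regularSection_subset_sectionPlus (m : Fin 3 → ℝ) (c : ℝ) (j : Fin 3) :
    regularSection m c j ⊆ sectionPlus m c j := fun _ hx =>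
  ⟨hx.1, mem_admissible_iff_gap.2 hx.2.1, hx.2.2.1, (hx.2.2.2 j hx.2.2.1).le⟩

theorem rescale_openingState_mem {m : Fin 3 → ℝ} (h : WideMasses m) {c : ℝ} (hc : 0 < c)
    {g : Fin 3 → ℝ} (hg : ∀ k, 0 ≤ g k) (hg' : ∃ k, 0 < g k) {j : Fin 3} (hj : g j = 0) :
    rescale m c (openingState m g) ∈ regularSection m c j := by
  refine rescale_mem_regularSection h.pos_all hc ?_ ?_ ?_ ?_ <;>
  simp only [gap_openingState, gapVel_openingState h.ne_zero]
  exacts [hg, hg', hj, fun _ _ => one_pos]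

theorem joinedIn_centre_centre {m : Fin 3 → ℝ} (h : WideMasses m) {c : ℝ} (hc : 0 < c)
    (j k : Fin 3) : JoinedIn (leastExpanding m c) (centre m c j) (centre m c k) := by
  obtain ⟨i, hij, hik⟩ : ∃ i : Fin 3, j ≠ i ∧ k ≠ i := by
    revert j k
    decide
  -- A state in which only gap `i` is open lies in both sections `j` and `k`, so both centres see
  -- it.
  have hmem : ∀ l, l ≠ i → rescale m c (openingState m fun k => if k = i then 1 else 0) ∈
      regularSection m c l := fun l hl =>
    rescale_openingState_mem h hc (fun k => by split_ifs <;> norm_num) ⟨i, by simp⟩ (by simp [hl])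
  exact (joinedIn_centre h hc (regularSection_subset_sectionPlus _ _ _ (hmem j hij))
    (h.regularSection_subset c j (hmem j hij))).symm.trans
    (joinedIn_centre h hc (regularSection_subset_sectionPlus _ _ _ (hmem k hik))
      (h.regularSection_subset c k (hmem k hik)))

theorem isPathConnected_leastExpanding {m : Fin 3 → ℝ} (h : WideMasses m) {c : ℝ} (hc : 0 < c) :
    IsPathConnected (leastExpanding m c) := by
  refine ⟨centre m c 0, (joinedIn_centre_centre h hc 0 0).source_mem, fun {x} hx => ?_⟩
  obtain ⟨j, hj⟩ := Set.mem_iUnion.1 hx.1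
  exact (joinedIn_centre_centre h hc 0 j).trans (joinedIn_centre h hc hj hx).symm

/-! ### Full measure -/

theorem continuous_restEnergy (m : Fin 3 → ℝ) (c : ℝ) (j : Fin 3) :
    Continuous (restEnergy m c j) := by
  unfold restEnergy
  simp only [div_eq_mul_inv]
  fin_cases j <;> simp <;> fun_prop

theorem continuous_chart (m : Fin 3 → ℝ) (c : ℝ) (j : Fin 3) : Continuous (chart m c j) := by
  have hr := fun j => continuous_restEnergy m c j
  unfold chart
  refine Continuous.prodMk (continuous_pi fun i => ?_) (continuous_pi fun i => ?_)
  · fin_cases j <;> fin_cases i <;> simp <;> fun_prop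
  · fin_cases j <;> fin_cases i <;> simp <;> fun_prop

theorem continuous_gap (j : Fin 3) : Continuous (gap j) := by
  unfold gap
  fin_cases j <;> simp <;> fun_prop

theorem continuous_gapVel (m : Fin 3 → ℝ) (j : Fin 3) : Continuous (gapVel m j) := by
  unfold gapVel vel
  simp only [div_eq_mul_inv]
  fin_cases j <;> simp <;> fun_prop

/-- The states of `𝓜ⱼ⁺` in which only one gap is closed, and opens. -/
def simpleSection (m : Fin 3 → ℝ) (c : ℝ) (j : Fin 3) : Set Phase :=
  {x | hamiltonian m x = c ∧ gap j x = 0 ∧ 0 < gapVel m j x ∧ ∀ k, k ≠ j → 0 < gap k x}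

theorem simpleSection_subset (m : Fin 3 → ℝ) (c : ℝ) (j : Fin 3) :
    simpleSection m c j ⊆ regularSection m c j := by
  rintro x ⟨hH, hj, hv, hk⟩
  refine ⟨hH, fun k => ?_, hj, fun k h0 => ?_⟩
  · by_cases h : k = j
    · rw [h, hj]
    · exact (hk k h).le
  · by_cases h : k = j
    · rwa [h]
    · exact absurd h0 (hk k h).ne'

theorem measurableSet_simpleSection (m : Fin 3 → ℝ) (c : ℝ) (j : Fin 3) :
    MeasurableSet (simpleSection m c j) := by
  refine (measurableSet_eq_fun (continuous_hamiltonian m).measurable measurable_const).inter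
    ((measurableSet_eq_fun (continuous_gap j).measurable measurable_const).inter
    ((measurableSet_lt measurable_const (continuous_gapVel m j).measurable).inter ?_))
  have : {x : Phase | ∀ k, k ≠ j → 0 < gap k x} = ⋂ k, ⋂ _ : k ≠ j, {x | 0 < gap k x} := by
    ext x
    simp
  change MeasurableSet {x : Phase | ∀ k, k ≠ j → 0 < gap k x}
  rw [this]
  exact MeasurableSet.iInter fun k => MeasurableSet.iInter fun _ =>
    measurableSet_lt measurable_const (continuous_gap k).measurable

theorem measurableSet_chartDomain (m : Fin 3 → ℝ) (c : ℝ) (j : Fin 3) :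
    MeasurableSet (chartDomain m c j) :=
  (measurableSet_le measurable_const (measurable_pi_apply 0)).inter
    ((measurableSet_le (measurable_pi_apply 0) (measurable_pi_apply 1)).inter
      (measurableSet_lt measurable_const (continuous_restEnergy m c j).measurable))

theorem ae_apply_ne_zero {ℓ : (Fin 4 → ℝ) →ₗ[ℝ] ℝ} (hℓ : ℓ ≠ 0) :
    ∀ᵐ y : Fin 4 → ℝ, ℓ y ≠ 0 := by
  have := Measure.addHaar_submodule (volume : Measure (Fin 4 → ℝ)) (LinearMap.ker ℓ)
    (fun h => hℓ (LinearMap.ker_eq_top.1 h))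
  rw [ae_iff]
  convert this using 2
  ext y
  simp

/-- For two balls at the same position, the square root is the momentum of their relative motion,
with the reduced mass and the kinetic energy `restEnergy`. Its sign makes the gap open. -/
theorem chart_mem_simpleSection {m : Fin 3 → ℝ} (hm : ∀ i, 0 < m i) {c : ℝ} {j : Fin 3}
    {y : Fin 4 → ℝ} (h0 : 0 < y 0) (h1 : y 0 < y 1) (hr : 0 < restEnergy m c j y) :
    chart m c j y ∈ simpleSection m c j := by
  have m0 := hm 0
  have m1 := hm 1
  have m2 := hm 2
  have hj : j = 0 ∨ j = 1 ∨ j = 2 := by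
    fin_cases j <;> simp
  rcases hj with rfl | rfl | rfl
  · have hE : 0 < 2 * m 0 * restEnergy m c 0 y := by positivity
    have hs := Real.sqrt_pos.2 hE
    have hs2 := Real.sq_sqrt hE.le
    have hdef : restEnergy m c 0 y =
      c - y 2 ^ 2 / (2 * m 1) - y 3 ^ 2 / (2 * m 2) - m 1 * y 0 - m 2 * y 1 := rfl
    refine ⟨?_, ?_, ?_, fun k hk => ?_⟩
    · simp [hamiltonian, Fin.sum_univ_three, chart]
      rw [hs2, mul_div_cancel_left₀ _ (by positivity), hdef]
      ring
    · simp [gap, chart]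
    · simp [gapVel, chart, vel]
      positivity
    · fin_cases k <;> simp [gap, chart] at hk ⊢ <;> linarith
  · have hE : 0 < 2 * (m 0 * m 1 / (m 0 + m 1)) * restEnergy m c 1 y := by positivity
    have hs := Real.sqrt_pos.2 hE
    have hs2 := Real.sq_sqrt hE.le
    have hdef : restEnergy m c 1 y = c - y 2 ^ 2 / (2 * (m 0 + m 1)) - y 3 ^ 2 / (2 * m 2)
      - (m 0 + m 1) * y 0 - m 2 * y 1 := rfl
    refine ⟨?_, ?_, ?_, fun k hk => ?_⟩
    · simp [hamiltonian, Fin.sum_univ_three, chart]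
      generalize √(2 * (m 0 * m 1 / (m 0 + m 1)) * restEnergy m c 1 y) = s at *
      have hc : c = s ^ 2 * (m 0 + m 1) / (2 * (m 0 * m 1)) + y 2 ^ 2 / (2 * (m 0 + m 1))
          + y 3 ^ 2 / (2 * m 2) + (m 0 + m 1) * y 0 + m 2 * y 1 := by
        rw [hs2, hdef]
        field_simp
        ring
      rw [hc]
      field_simp
      ring
    · simp [gap, chart]
    · simp [gapVel, chart, vel]
      generalize √(2 * (m 0 * m 1 / (m 0 + m 1)) * restEnergy m c 1 y) = s at *
      rw [div_lt_div_iff₀ m0 m1]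
      have : m 0 / (m 0 + m 1) * y 2 * m 1 = m 1 / (m 0 + m 1) * y 2 * m 0 := by ring
      nlinarith
    · fin_cases k <;> simp [gap, chart] at hk ⊢ <;> linarith
  · have hE : 0 < 2 * (m 1 * m 2 / (m 1 + m 2)) * restEnergy m c 2 y := by positivity
    have hs := Real.sqrt_pos.2 hE
    have hs2 := Real.sq_sqrt hE.le
    have hdef : restEnergy m c 2 y = c - y 2 ^ 2 / (2 * m 0) - y 3 ^ 2 / (2 * (m 1 + m 2))
      - m 0 * y 0 - (m 1 + m 2) * y 1 := rfl
    refine ⟨?_, ?_, ?_, fun k hk => ?_⟩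
    · simp [hamiltonian, Fin.sum_univ_three, chart]
      generalize √(2 * (m 1 * m 2 / (m 1 + m 2)) * restEnergy m c 2 y) = s at *
      have hc : c = s ^ 2 * (m 1 + m 2) / (2 * (m 1 * m 2)) + y 2 ^ 2 / (2 * m 0)
          + y 3 ^ 2 / (2 * (m 1 + m 2)) + m 0 * y 0 + (m 1 + m 2) * y 1 := by
        rw [hs2, hdef]
        field_simp
        ring
      rw [hc]
      field_simp
      ring
    · simp [gap, chart]
    · simp [gapVel, chart, vel]
      generalize √(2 * (m 1 * m 2 / (m 1 + m 2)) * restEnergy m c 2 y) = s at *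
      rw [div_lt_div_iff₀ m1 m2]
      have : m 1 / (m 1 + m 2) * y 3 * m 2 = m 2 / (m 1 + m 2) * y 3 * m 1 := by ring
      nlinarith
    · fin_cases k <;> simp [gap, chart] at hk ⊢ <;> linarith

/-- The measure is an image of measures absolutely continuous with respect to Lebesgue measure. In
each chart domain, the states with a further closed gap lie on the null hyperplanes `y 0 = 0` and `y
0 = y 1`. -/
theorem ae_mem_leastExpanding {m : Fin 3 → ℝ} (h : WideMasses m) (c : ℝ) :
    ∀ᵐ x ∂sectionMeasure m c, x ∈ leastExpanding m c := by
  rw [sectionMeasure, ← Measure.sum_fintype, Measure.ae_sum_iff]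
  intro j
  have hmeas := measurableSet_simpleSection m c j
  refine Filter.Eventually.mono ((ae_map_iff (p := (· ∈ simpleSection m c j))
    (continuous_chart m c j).measurable.aemeasurable hmeas).2 ?_) fun x hx =>
    h.regularSection_subset c j (simpleSection_subset m c j hx)
  refine (withDensity_absolutelyContinuous _ _).ae_le ?_
  have hne : ∀ {ℓ : (Fin 4 → ℝ) →ₗ[ℝ] ℝ} (v : Fin 4 → ℝ), ℓ v ≠ 0 → ℓ ≠ 0 := fun v hv h0 =>
    hv (by rw [h0, LinearMap.zero_apply])
  have e0 : ∀ᵐ y : Fin 4 → ℝ, y 0 ≠ 0 :=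
    ae_apply_ne_zero (ℓ := LinearMap.proj 0) (hne 1 (by simp))
  have e1 : ∀ᵐ y : Fin 4 → ℝ, y 1 - y 0 ≠ 0 := by
    let ℓ : (Fin 4 → ℝ) →ₗ[ℝ] ℝ := .proj 1
    let ℓ' : (Fin 4 → ℝ) →ₗ[ℝ] ℝ := .proj 0
    exact ae_apply_ne_zero (ℓ := ℓ - ℓ') (hne (Pi.single 1 1) (by simp [ℓ, ℓ']))
  filter_upwards [ae_restrict_mem (measurableSet_chartDomain m c j), ae_restrict_of_ae e0,
    ae_restrict_of_ae e1] with y hy h0 h1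
  obtain ⟨hy0, hy1, hy2⟩ := hy
  exact chart_mem_simpleSection h.pos_all (lt_of_le_of_ne hy0 h0.symm)
    (lt_of_le_of_ne hy1 fun e => h1 (by rw [e, sub_self])) hy2

end FallingBalls

end

theorem mainTheorem3 (m : Fin 3 → ℝ) (c : ℝ)
    (hm2 : 0 < m 2) (hm21 : m 2 ≤ m 1) (hm10 : m 1 < m 0)
    (hmass : 2 * √(m 0) * √(m 2) = √(m 0 + m 1) * √(m 1 + m 2))
    (hc : 0 < c) :
    (∀ᵐ x ∂(FallingBalls.sectionMeasure m c), x ∈ FallingBalls.leastExpanding m c) ∧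
      IsPathConnected (FallingBalls.leastExpanding m c) := by
  have h := FallingBalls.wideMasses_of_sqrt hm2 hm21 hm10 hmass
  exact ⟨FallingBalls.ae_mem_leastExpanding h c, FallingBalls.isPathConnected_leastExpanding h hc⟩
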